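/- **Setting.** Let $\mathcal M$ be a nonempty finite set of models, $\Pi$ a measurable space of decisions and $\mathcal O$ a measurable space of observations, where $\Pi$ is countable or the $\sigma$-algebra of $\mathcal O$ is countably generated (for instance $\Pi$ a compact metric space and $\mathcal O$ a separable locally compact metric space). Each $M\in\mathcal M$ is a Markov kernel $\pi\mapsto M(\pi)$ from $\Pi$ to $\mathcal O$ with a measurable mean reward function $f_M:\Pi\to\mathbb R$ and a maximizer $\pi_M\in\arg\max_{\pi}f_M(\pi)$. Write $\Delta(\cdot)$ for sets of probability measures. For $\mu\in\Delta(\mathcal M)$ let $\mu_{o|\pi}=\sum_M\mu(M)M(\pi)$, and let $\mu(\cdot|\pi,o)$ be the Bayesian posterior of $M$ given that decision $\pi$ led to observation $o\sim M(\pi)$; it is given by Bayes' rule with likelihoods that are densities jointly measurable in $(\pi,o)$, and has a conventional value on the $\mu_{o|\pi}$-null set where Bayes' rule is undefined. For $\eta>0$, $\rho,\mu\in\Delta(\mathcal M)$ and $p\in\Delta(\Pi)$ let $$\mathrm{MAIR}_{\rho,\eta}(p,\mu)=\mathbb E_{M\sim\mu,\ \pi\sim p,\ o\sim M(\pi)}\Big[f_M(\pi_M)-f_M(\pi)-\tfrac1\eta\mathrm{KL}\big(\mu(\cdot|\pi,o),\rho\big)\Big]$$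 (extended-valued, the gap and KL terms being integrated separately, with $\infty-\infty=-\infty$), and, with the same conventions and with $\mathrm{conv}(\mathcal M)$ the set of mixtures $\bar M(\pi)=\sum_M w(M)M(\pi)$, $w\in\Delta(\mathcal M)$, $$\mathrm{DEC}^{\mathrm{KL}}_\eta(\mathcal M)=\sup_{\bar M\in\mathrm{conv}(\mathcal M)}\ \inf_{p\in\Delta(\Pi)}\ \sup_{M\in\mathcal M}\ \mathbb E_{\pi\sim p}\Big[f_M(\pi_M)-f_M(\pi)-\tfrac1\eta\mathrm{KL}\big(M(\pi),\bar M(\pi)\big)\Big].$$ **Algorithm (Model-index Adaptive Minimax Sampling, MAMS).** Fix a true model $M^*\in\mathcal M$ and let $\rho_1$ be uniform on $\mathcal M$. At round $t=1,\dots,T$, choose, as measurable functions of the past decisions and observations, $p_t\in\Delta(\Pi)$ and $\mu_t\in\Delta(\mathcal M)$ such that, almost surely, $(p_t,\mu_t)$ is a saddle point of $\inf_{p\in\Delta(\Pi)}\sup_{\mu\in\Delta(\mathcal M)}\mathrm{MAIR}_{\rho_t,\eta}(p,\mu)$, that is, $\mathrm{MAIR}_{\rho_t,\eta}(p_t,\mu)\le\mathrm{MAIR}_{\rho_t,\eta}(p,\mu_t)$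 for all $p$ and $\mu$; sample $\pi_t\sim p_t$, observe $o_t\sim M^*(\pi_t)$, and put $\rho_{t+1}=\mu_t(\cdot|\pi_t,o_t)$. Assume that Bayes' rule always applies to the actual observation: for every $t\le T$, almost surely, $M^*(\pi_t)\ll(\mu_t)_{o|\pi_t}$. (This holds for instance if, for each $\pi$, the laws $M(\pi)$, $M\in\mathcal M$, are mutually absolutely continuous.) **Theorem (regret of MAMS).** For every $\eta>0$, every $M^*\in\mathcal M$, every $T\in\mathbb N$ and every such run of MAMS, the values $\mathrm{MAIR}_{\rho_t,\eta}(p_t,\mu_t)$ are almost surely finite, the random variables $\sum_{t=1}^T\big(f_{M^*}(\pi_{M^*})-f_{M^*}(\pi_t)\big)$ and $\sum_{t=1}^T\mathrm{MAIR}_{\rho_t,\eta}(p_t,\mu_t)$ are integrable, and the regret $\mathrm{Reg}_T=\mathbb E\big[\sum_{t=1}^T(f_{M^*}(\pi_{M^*})-f_{M^*}(\pi_t))\big]$ satisfies $$\mathrm{Reg}_T\ \le\ \frac{\log|\mathcal M|}{\eta}+\mathbb E\Big[\sum_{t=1}^T\mathrm{MAIR}_{\rho_t,\eta}(p_t,\mu_t)\Big]\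 \le\ \frac{\log|\mathcal M|}{\eta}+\mathrm{DEC}^{\mathrm{KL}}_\eta(\mathcal M)\cdot T .$$ -/

import Mathlib

open MeasureTheory ProbabilityTheory
open scoped ENNReal

namespace MAMS

/-- A stochastic decision-making problem with structured observations. `D` is the decision space,
`O` the observation space, and the finite type `𝓜` indexes the model class. The model `M` maps a
decision `π` to the law `obs M π` of the observation, has mean reward function `reward M`, and
`opt M` is a decision of maximal mean reward under `M`. -/
structure DecisionProblem (𝓜 D O : Type*) [MeasurableSpace D] [MeasurableSpace O] where
  obs : 𝓜 → Kernel D O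
  isMarkov_obs : ∀ M, IsMarkovKernel (obs M)
  reward : 𝓜 → D → ℝ
  measurable_reward : ∀ M, Measurable (reward M)
  opt : 𝓜 → D
  reward_le_opt : ∀ M π, reward M π ≤ reward M (opt M)

attribute [instance] DecisionProblem.isMarkov_obs

/-- Kullback-Leibler divergence between two distributions on a finite set
(`∞` if the first is not absolutely continuous with respect to the second). -/
noncomputable def pmfKL {α : Type*} (p q : PMF α) : ℝ≥0∞ :=
  @InformationTheory.klDiv α ⊤ (@PMF.toMeasure α ⊤ p) (@PMF.toMeasure α ⊤ q)

/-- The space of histories of `t` rounds: past decisions and observations. -/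
abbrev Hist (D O : Type*) (t : ℕ) : Type _ := Fin t → D × O

/-- The rounds before round `t` of a history of `T` rounds (rounds are numbered from `0`). -/
def past {D O : Type*} {T : ℕ} (h : Hist D O T) (t : Fin T) : Hist D O t :=
  fun i => h (Fin.castLE t.2.le i)

namespace DecisionProblem

variable {𝓜 D O : Type*} [Fintype 𝓜] [MeasurableSpace D] [MeasurableSpace O]

/-- The suboptimality `f_M(π_M) - f_M(π)`. -/
def gap (P : DecisionProblem 𝓜 D O) (M : 𝓜) (π : D) : ℝ :=
  P.reward M (P.opt M) - P.reward M π

/-- The total regret of a history against the optimal decision `π_M` of the model `M`. -/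
def cumRegret (P : DecisionProblem 𝓜 D O) (M : 𝓜) {T : ℕ} (h : Hist D O T) : ℝ :=
  ∑ t : Fin T, (P.reward M (P.opt M) - P.reward M (h t).1)

/-- The expectation of the nonnegative function `gap M` under `p`, with values in `[0, ∞]`. -/
noncomputable def expGap (P : DecisionProblem 𝓜 D O) (M : 𝓜) (p : Measure D) : ℝ≥0∞ :=
  ∫⁻ π, ENNReal.ofReal (P.gap M π) ∂p

/-- The mixture model with weights `μ`; it is the predictive law of the observation after decision
`π` under the belief `μ`, and the convex hull of the model class is the set of all such mixtures. -/
noncomputable def mixture (P : DecisionProblem 𝓜 D O) (μ : PMF 𝓜) (π : D) : Measure O :=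
  ∑ M, μ M • P.obs M π

/-- The KL version of the decision-estimation coefficient of the model class:
`sup` over reference models in the convex hull, `inf` over decision distributions, `sup` over
models of the class. -/
noncomputable def decKL (P : DecisionProblem 𝓜 D O) (η : ℝ) : EReal :=
  ⨆ w : PMF 𝓜, ⨅ p : ProbabilityMeasure D, ⨆ M : 𝓜,
    ((P.expGap M p : ℝ≥0∞) : EReal) -
      ((ENNReal.ofReal (1 / η) *
        ∫⁻ π, InformationTheory.klDiv (P.obs M π) (P.mixture w π) ∂(p : Measure D) : ℝ≥0∞) : EReal)

variable [MeasurableSpace.CountableOrCountablyGenerated D O]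

/-- The likelihood of model `M` at the observation `o` after decision `π`: the density of `obs M π`
with respect to the sum of all observation laws, jointly measurable in `(π, o)`. -/
noncomputable def likelihood (P : DecisionProblem 𝓜 D O) (M : 𝓜) (π : D) (o : O) : ℝ≥0∞ :=
  Kernel.rnDeriv (P.obs M) (∑ M', P.obs M') π o

open Classical in
/-- The Bayesian posterior of the prior `μ` given decision `π` and observation `o`: the weight of `M`
is proportional to `μ M * likelihood M π o`. Where Bayes' rule is undefined (a null set for the
predictive law), an arbitrary value, here `μ`, is used. -/
noncomputable def posterior (P : DecisionProblem 𝓜 D O) (μ : PMF 𝓜) (π : D) (o : O) : PMF 𝓜 :=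
  if h : (∑' M, μ M * P.likelihood M π o) ≠ 0 ∧ (∑' M, μ M * P.likelihood M π o) ≠ ∞ then
    PMF.normalize (fun M => μ M * P.likelihood M π o) h.1 h.2
  else μ

/-- The model-index algorithmic information ratio: the expectation, for `M ∼ μ`, `π ∼ p` and
`o ∼ M(π)`, of `f_M(π_M) - f_M(π) - (1 / η) KL(μ(· | π, o), ρ)`. -/
noncomputable def mair (P : DecisionProblem 𝓜 D O) (ρ : PMF 𝓜) (η : ℝ) (p : Measure D)
    (μ : PMF 𝓜) : EReal :=
  ((∑ M, μ M * P.expGap M p : ℝ≥0∞) : EReal) -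
    ((ENNReal.ofReal (1 / η) *
      ∑ M, μ M * ∫⁻ π, ∫⁻ o, pmfKL (P.posterior μ π o) ρ ∂(P.obs M π) ∂p : ℝ≥0∞) : EReal)

end DecisionProblem

/-- An algorithm that, at each round and as a function of the history, chooses a distribution over
decisions and a belief over models. -/
structure BeliefAlgorithm (𝓜 D O : Type*) [MeasurableSpace D] [MeasurableSpace O] where
  policy : (t : ℕ) → Kernel (Hist D O t) D
  isMarkov_policy : ∀ t, IsMarkovKernel (policy t)
  belief : (t : ℕ) → Hist D O t → PMF 𝓜
  measurable_belief : ∀ t M, Measurable fun h => belief t h M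

attribute [instance] BeliefAlgorithm.isMarkov_policy

namespace BeliefAlgorithm

variable {𝓜 D O : Type*} [Fintype 𝓜] [MeasurableSpace D] [MeasurableSpace O]

/-- The law of the history of the first `t` rounds when the true model is `Mstar`: at each round
`π ∼ policy` and `o ∼ Mstar(π)`. -/
noncomputable def law (A : BeliefAlgorithm 𝓜 D O) (P : DecisionProblem 𝓜 D O) (Mstar : 𝓜) :
    (t : ℕ) → Measure (Hist D O t)
  | 0 => Measure.dirac Fin.elim0
  | t + 1 =>
    (A.law P Mstar t ⊗ₘ (A.policy t ⊗ₖ Kernel.prodMkLeft (Hist D O t) (P.obs Mstar))).map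
      fun x => Fin.snoc (α := fun _ => D × O) x.1 x.2

variable [Nonempty 𝓜] [MeasurableSpace.CountableOrCountablyGenerated D O]

/-- The reference distribution over models at each round: uniform at the first round, then the
posterior, given the last decision and observation, of the last belief. -/
noncomputable def ref (A : BeliefAlgorithm 𝓜 D O) (P : DecisionProblem 𝓜 D O) :
    (t : ℕ) → Hist D O t → PMF 𝓜
  | 0, _ => PMF.uniformOfFintype 𝓜
  | t + 1, h =>
    P.posterior (A.belief t (Fin.init h)) (h (Fin.last t)).1 (h (Fin.last t)).2

/-- The value of MAIR at the round following the history `h`. -/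
noncomputable def mairAt (A : BeliefAlgorithm 𝓜 D O) (P : DecisionProblem 𝓜 D O) (η : ℝ) {t : ℕ}
    (h : Hist D O t) : EReal :=
  P.mair (A.ref P t h) η (A.policy t h) (A.belief t h)

/-- `A` runs Model-index Adaptive Minimax Sampling for `T` rounds under the true model `Mstar`:
almost surely, at each round, its decision distribution and its belief form a saddle point of
`inf_p sup_μ MAIR_{ρ, η}(p, μ)`, where `ρ` is the current reference distribution. -/
def IsMAMS (A : BeliefAlgorithm 𝓜 D O) (P : DecisionProblem 𝓜 D O) (Mstar : 𝓜) (η : ℝ)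
    (T : ℕ) : Prop :=
  ∀ t < T, ∀ᵐ h ∂(A.law P Mstar t),
    IsSaddlePointOn {p : Measure D | IsProbabilityMeasure p} (Set.univ : Set (PMF 𝓜))
      (fun p μ => P.mair (A.ref P t h) η p μ) (A.policy t h) (A.belief t h)

/-- Almost surely, Bayes' rule applies to the observation at each of the `T` rounds: the true law of
the observation is dominated by its predictive law under the current belief. -/
def BayesApplies (A : BeliefAlgorithm 𝓜 D O) (P : DecisionProblem 𝓜 D O) (Mstar : 𝓜)
    (T : ℕ) : Prop :=
  ∀ t < T, ∀ᵐ h ∂(A.law P Mstar t), ∀ᵐ π ∂(A.policy t h),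
    P.obs Mstar π ≪ P.mixture (A.belief t h) π

end BeliefAlgorithm

end MAMS

/-! The potential is the logarithmic loss `-log ρ_t(M*)` of the true model: it starts at `log |𝓜|`
and is never negative. By `infoGain_add_sum_expLogLoss`, the information gain in MAIR is the cross
entropy of belief and reference, which is linear in the belief, minus the conditional entropy of the
model given decision and observation, which is concave. The first-order condition for the maximizing
belief `μ_t`, in the direction of the point mass at `M*` (`expGap_add_le_of_forall_mair_le`), says:
the expected gap plus `1/η` times the expected loss after the Bayes update is at most the MAIR value
plus `1/η` times the loss before it. Summation over the rounds telescopes (`round_bound`,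
`regret_potential_bound`).

No derivative is taken. Gibbs' inequality gives a bound at each mixture `(1 - ε) μ + ε δ_M`, and
Fatou's lemma lets `ε → 0`; the domination hypothesis makes the perturbed posteriors converge almost
surely under `M*`.

For the second inequality, Gibbs' inequality bounds the information gain below by the mutual
information, the average divergence of the models from their mixture. An average over models is at
most a supremum, and optimality of `p_t` against `μ_t` supplies the infimum over decisions
(`mair_le_iSup`, `mair_le_decKL`). -/

namespace MAMS

/-! ### Logarithmic loss and divergence through a density. -/

/-- The logarithmic loss `-log x` of a probability `x`, with value `∞` at `0`. -/
noncomputable def logLoss (x : ℝ≥0∞) : ℝ≥0∞ := (-ENNReal.log x).toENNReal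

lemma continuous_logLoss : Continuous logLoss :=
  EReal.continuous_toENNReal.comp (continuous_neg.comp ENNReal.continuous_log)

lemma measurable_logLoss : Measurable logLoss := continuous_logLoss.measurable

@[simp] lemma logLoss_zero : logLoss 0 = ∞ := by simp [logLoss]

lemma logLoss_eq_ofReal {x : ℝ≥0∞} (h0 : x ≠ 0) (h1 : x ≠ ∞) :
    logLoss x = ENNReal.ofReal (-Real.log x.toReal) := by
  rw [logLoss, ENNReal.log_pos_real h0 h1, ← EReal.coe_neg, EReal.toENNReal_of_ne_top (by simp)]
  simp

lemma logLoss_ne_top {x : ℝ≥0∞} (h0 : x ≠ 0) : logLoss x ≠ ∞ := by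
  by_cases h1 : x = ∞
  · simp [h1, logLoss]
  · simp [logLoss_eq_ofReal h0 h1]

lemma ne_zero_of_logLoss_ne_top {x : ℝ≥0∞} (h : logLoss x ≠ ∞) : x ≠ 0 := by
  rintro rfl
  simp at h

lemma toReal_logLoss {x : ℝ≥0∞} (h0 : x ≠ 0) (h1 : x ≤ 1) :
    (logLoss x).toReal = -Real.log x.toReal := by
  rw [logLoss_eq_ofReal h0 (ne_top_of_le_ne_top ENNReal.one_ne_top h1), ENNReal.toReal_ofReal]
  have : x.toReal ≤ 1 := by
    simpa using ENNReal.toReal_mono ENNReal.one_ne_top h1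
  linarith [Real.log_nonpos ENNReal.toReal_nonneg this]

/-- Both measures have mass one, so the mass correction in `klDiv` vanishes and the integral of the
log-density remains. -/
lemma klDiv_withDensity {Ω : Type*} {mΩ : MeasurableSpace Ω} (μ ν : Measure Ω)
    [IsProbabilityMeasure μ] [IsProbabilityMeasure ν] (f : Ω → ℝ≥0∞) (hf : Measurable f)
    (h : μ = ν.withDensity f) (hint : Integrable (fun x => Real.log (f x).toReal) μ) :
    InformationTheory.klDiv μ ν ≠ ∞ ∧
      (InformationTheory.klDiv μ ν).toReal = ∫ x, Real.log (f x).toReal ∂μ := by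
  have hac : μ ≪ ν := h ▸ withDensity_absolutelyContinuous ν f
  have hll : llr μ ν =ᵐ[μ] fun x => Real.log (f x).toReal := by
    apply hac.ae_le
    have : μ.rnDeriv ν =ᵐ[ν] f := by
      rw [h]; exact Measure.rnDeriv_withDensity ν hf
    filter_upwards [this] with x hx
    simp [llr, hx]
  refine ⟨InformationTheory.klDiv_ne_top hac (hint.congr hll.symm), ?_⟩
  rw [InformationTheory.toReal_klDiv_of_measure_eq hac (by simp), integral_congr_ae hll]

/-! ### Entropy and divergence on a finite set. -/

section Finite

variable {α : Type*} [Fintype α]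

lemma sum_pmf_eq_one (q : PMF α) : ∑ a, q a = 1 := by
  rw [← q.tsum_coe, tsum_fintype]

lemma sum_toReal_pmf_eq_one (q : PMF α) : ∑ a, (q a).toReal = 1 := by
  rw [← ENNReal.toReal_sum fun a _ => q.apply_ne_top a, sum_pmf_eq_one]
  simp

lemma pmfKL_eq_top (q r : PMF α) {a : α} (hq : q a ≠ 0) (hr : r a = 0) : pmfKL q r = ∞ := by
  let _ : MeasurableSpace α := ⊤
  apply InformationTheory.klDiv_of_not_ac
  intro h
  have h1 : r.toMeasure {a} = 0 := by
    rw [PMF.toMeasure_apply_singleton _ _ (measurableSet_singleton a), hr]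
  have h2 := h h1
  rw [PMF.toMeasure_apply_singleton _ _ (measurableSet_singleton a)] at h2
  exact hq h2

lemma toReal_pmfKL (q r : PMF α) (h : ∀ a, r a = 0 → q a = 0) :
    pmfKL q r ≠ ∞ ∧
      (pmfKL q r).toReal = ∑ a, (q a).toReal * Real.log (q a / r a).toReal := by
  let _ : MeasurableSpace α := ⊤
  have : DiscreteMeasurableSpace α := ⟨fun _ => trivial⟩
  have key : q.toMeasure = r.toMeasure.withDensity fun a => q a / r a := by
    apply Measure.ext_of_singleton
    intro a
    rw [withDensity_apply _ (measurableSet_singleton a), Measure.restrict_singleton,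
      lintegral_smul_measure, lintegral_dirac,
      PMF.toMeasure_apply_singleton _ _ (measurableSet_singleton a),
      PMF.toMeasure_apply_singleton _ _ (measurableSet_singleton a), smul_eq_mul]
    exact (ENNReal.mul_div_cancel' (h a) fun h => absurd h (r.apply_ne_top a)).symm
  obtain ⟨h1, h2⟩ := klDiv_withDensity q.toMeasure r.toMeasure (fun a => q a / r a)
    (measurable_of_finite _) key .of_finite
  refine ⟨h1, h2.trans ?_⟩
  rw [PMF.integral_eq_sum]
  rfl

/-- The cross entropy of `q` and `r` is the sum of the divergence and of the entropy of `q`. -/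
lemma pmfKL_add_sum_logLoss (q r : PMF α) :
    pmfKL q r + ∑ a, q a * logLoss (q a) = ∑ a, q a * logLoss (r a) := by
  by_cases h : ∀ a, r a = 0 → q a = 0
  · obtain ⟨h1, h2⟩ := toReal_pmfKL q r h
    have f1 : ∀ a, q a * logLoss (q a) ≠ ∞ := fun a => by
      by_cases ha : q a = 0
      · simp [ha]
      · exact ENNReal.mul_ne_top (q.apply_ne_top a) (logLoss_ne_top ha)
    have f2 : ∀ a, q a * logLoss (r a) ≠ ∞ := fun a => by
      by_cases ha : q a = 0
      · simp [ha]
      · exact ENNReal.mul_ne_top (q.apply_ne_top a) (logLoss_ne_top fun hr => ha (h a hr))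
    have s1 : ∑ a, q a * logLoss (q a) ≠ ∞ := ENNReal.sum_ne_top.2 fun a _ => f1 a
    rw [← ENNReal.toReal_eq_toReal_iff' (ENNReal.add_ne_top.2 ⟨h1, s1⟩)
      (ENNReal.sum_ne_top.2 fun a _ => f2 a), ENNReal.toReal_add h1 s1, h2,
      ENNReal.toReal_sum fun a _ => f1 a, ENNReal.toReal_sum fun a _ => f2 a,
      ← Finset.sum_add_distrib]
    refine Finset.sum_congr rfl fun a _ => ?_
    by_cases ha : q a = 0
    · simp [ha]
    have hr : r a ≠ 0 := fun hr => ha (h a hr)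
    rw [ENNReal.toReal_mul, ENNReal.toReal_mul, toReal_logLoss ha (q.coe_le_one a),
      toReal_logLoss hr (r.coe_le_one a), ENNReal.toReal_div,
      Real.log_div (ENNReal.toReal_ne_zero.2 ⟨ha, q.apply_ne_top a⟩)
        (ENNReal.toReal_ne_zero.2 ⟨hr, r.apply_ne_top a⟩)]
    ring
  -- Without absolute continuity both sides are infinite.
  · push Not at h
    obtain ⟨a, hr, hq⟩ := h
    rw [pmfKL_eq_top q r hq hr, top_add, eq_comm, ENNReal.sum_eq_top]
    exact ⟨a, Finset.mem_univ a, by simp [hr, hq]⟩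

/-- Gibbs' inequality. -/
lemma sum_logLoss_self_le (q r : PMF α) :
    ∑ a, q a * logLoss (q a) ≤ ∑ a, q a * logLoss (r a) := by
  rw [← pmfKL_add_sum_logLoss q r]
  exact le_add_self

lemma logLoss_uniform [Nonempty α] (a : α) :
    logLoss (PMF.uniformOfFintype α a) = ENNReal.ofReal (Real.log (Fintype.card α)) := by
  rw [logLoss_eq_ofReal (by simp) (by simp)]
  simp

/-- Gibbs' inequality against the uniform distribution. The resulting finiteness of entropies
justifies the later cancellations. -/
lemma sum_logLoss_self_le_log_card [Nonempty α] (q : PMF α) :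
    ∑ a, q a * logLoss (q a) ≤ ENNReal.ofReal (Real.log (Fintype.card α)) := by
  refine (sum_logLoss_self_le q (PMF.uniformOfFintype α)).trans_eq ?_
  simp_rw [logLoss_uniform]
  rw [← Finset.sum_mul, sum_pmf_eq_one, one_mul]

/-- Truncated subtraction is exact because the entropy is finite, even when the divergence is not.
This form makes measurability evident. -/
lemma pmfKL_eq_sub [Nonempty α] (q r : PMF α) :
    pmfKL q r = ∑ a, q a * logLoss (r a) - ∑ a, q a * logLoss (q a) := by
  rw [← pmfKL_add_sum_logLoss q r]
  exact (ENNReal.add_sub_cancel_right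
    (ne_top_of_le_ne_top ENNReal.ofReal_ne_top (sum_logLoss_self_le_log_card q))).symm

lemma measurable_pmfKL [Nonempty α] {Ω : Type*} [MeasurableSpace Ω] {q r : Ω → PMF α}
    (hq : ∀ a, Measurable fun x => q x a) (hr : ∀ a, Measurable fun x => r x a) :
    Measurable fun x => pmfKL (q x) (r x) := by
  simp_rw [pmfKL_eq_sub]
  exact (Finset.measurable_fun_sum _ fun a _ => (hq a).mul (measurable_logLoss.comp (hr a))).sub
    (Finset.measurable_fun_sum _ fun a _ => (hq a).mul (measurable_logLoss.comp (hq a)))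

/-- The mixture `(1 - ε) μ + ε ν` of two distributions. -/
noncomputable def pmfMix (ε : ℝ≥0∞) (hε : ε ≤ 1) (μ ν : PMF α) : PMF α :=
  PMF.ofFintype (fun a => (1 - ε) * μ a + ε * ν a) <| by
    rw [Finset.sum_add_distrib, ← Finset.mul_sum, ← Finset.mul_sum, sum_pmf_eq_one,
      sum_pmf_eq_one, mul_one, mul_one, tsub_add_cancel_of_le hε]

lemma pmfMix_apply (ε : ℝ≥0∞) (hε : ε ≤ 1) (μ ν : PMF α) (a : α) :
    pmfMix ε hε μ ν a = (1 - ε) * μ a + ε * ν a := rfl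

lemma sum_pmfMix_pure (ε : ℝ≥0∞) (hε : ε ≤ 1) (μ : PMF α) (a : α) (f : α → ℝ≥0∞) :
    ∑ b, pmfMix ε hε μ (PMF.pure a) b * f b = (1 - ε) * ∑ b, μ b * f b + ε * f a := by
  classical
  simp_rw [pmfMix_apply, add_mul, Finset.sum_add_distrib, mul_assoc, ← Finset.mul_sum,
    PMF.pure_apply]
  simp

end Finite

/-! ### Densities, evidence and Bayes' rule. -/

namespace DecisionProblem

variable {𝓜 D O : Type*} [Fintype 𝓜] [MeasurableSpace D] [MeasurableSpace O]

/-- The kernel dominating all models. -/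
noncomputable def baseKernel (P : DecisionProblem 𝓜 D O) : Kernel D O := ∑ M', P.obs M'

lemma baseKernel_apply (P : DecisionProblem 𝓜 D O) (π : D) :
    P.baseKernel π = ∑ M, P.obs M π := by
  simp [baseKernel]

instance (P : DecisionProblem 𝓜 D O) : IsFiniteKernel P.baseKernel := by
  refine ⟨⟨Fintype.card 𝓜, by simp, fun π => ?_⟩⟩
  rw [baseKernel_apply]
  simp

lemma lintegral_mixture (P : DecisionProblem 𝓜 D O) (ν : PMF 𝓜) (π : D) (f : O → ℝ≥0∞) :
    ∫⁻ o, f o ∂(P.mixture ν π) = ∑ M, ν M * ∫⁻ o, f o ∂(P.obs M π) := by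
  rw [mixture, lintegral_finsetSum_measure]
  simp

instance (P : DecisionProblem 𝓜 D O) (ν : PMF 𝓜) (π : D) :
    IsProbabilityMeasure (P.mixture ν π) := by
  refine ⟨?_⟩
  simp [mixture, sum_pmf_eq_one]

variable [MeasurableSpace.CountableOrCountablyGenerated D O]

lemma measurable_likelihood (P : DecisionProblem 𝓜 D O) (M : 𝓜) :
    Measurable fun x : D × O => P.likelihood M x.1 x.2 :=
  Kernel.measurable_rnDeriv _ _

lemma obs_eq_withDensity (P : DecisionProblem 𝓜 D O) (M : 𝓜) (π : D) :
    P.obs M π = (P.baseKernel π).withDensity (P.likelihood M π) := by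
  have hac : P.obs M π ≪ P.baseKernel π := by
    rw [baseKernel_apply]
    intro s hs
    rw [Measure.finsetSum_apply, Finset.sum_eq_zero_iff] at hs
    exact hs M (Finset.mem_univ M)
  have h : P.likelihood M π =ᵐ[P.baseKernel π] (P.obs M π).rnDeriv (P.baseKernel π) :=
    Kernel.rnDeriv_eq_rnDeriv_measure
  rw [withDensity_congr_ae h, Measure.withDensity_rnDeriv_eq _ _ hac]

lemma ae_likelihood_ne_top (P : DecisionProblem 𝓜 D O) (M : 𝓜) (π : D) :
    ∀ᵐ o ∂(P.baseKernel π), P.likelihood M π o ≠ ∞ := by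
  have h : P.likelihood M π =ᵐ[P.baseKernel π] (P.obs M π).rnDeriv (P.baseKernel π) :=
    Kernel.rnDeriv_eq_rnDeriv_measure
  filter_upwards [h, Measure.rnDeriv_ne_top (P.obs M π) (P.baseKernel π)] with o h1 h2
  rwa [h1]

/-- The density of the predictive law. -/
noncomputable def evidence (P : DecisionProblem 𝓜 D O) (ν : PMF 𝓜) (π : D) (o : O) : ℝ≥0∞ :=
  ∑ M, ν M * P.likelihood M π o

lemma measurable_likelihood_right (P : DecisionProblem 𝓜 D O) (M : 𝓜) (π : D) :
    Measurable (P.likelihood M π) :=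
  (P.measurable_likelihood M).comp measurable_prodMk_left

lemma measurable_evidence_right (P : DecisionProblem 𝓜 D O) (ν : PMF 𝓜) (π : D) :
    Measurable (P.evidence ν π) :=
  Finset.measurable_fun_sum _ fun M _ => (P.measurable_likelihood_right M π).const_mul _

lemma mixture_eq_withDensity (P : DecisionProblem 𝓜 D O) (ν : PMF 𝓜) (π : D) :
    P.mixture ν π = (P.baseKernel π).withDensity (P.evidence ν π) := by
  ext s hs
  rw [withDensity_apply _ hs]
  unfold evidence
  rw [lintegral_finsetSum _ fun M _ => (P.measurable_likelihood_right M π).const_mul _]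
  simp only [mixture, Measure.finsetSum_apply, Measure.smul_apply, smul_eq_mul]
  refine Finset.sum_congr rfl fun M _ => ?_
  rw [lintegral_const_mul _ (P.measurable_likelihood_right M π), ← withDensity_apply _ hs,
    ← obs_eq_withDensity]

lemma ae_evidence_ne_top (P : DecisionProblem 𝓜 D O) (ν : PMF 𝓜) (π : D) :
    ∀ᵐ o ∂(P.baseKernel π), P.evidence ν π o ≠ ∞ := by
  filter_upwards [ae_all_iff.2 fun M => P.ae_likelihood_ne_top M π] with o h
  exact ENNReal.sum_ne_top.2 fun M _ => ENNReal.mul_ne_top (ν.apply_ne_top M) (h M)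

lemma ae_evidence_ne_zero (P : DecisionProblem 𝓜 D O) (ν : PMF 𝓜) (π : D) :
    ∀ᵐ o ∂(P.mixture ν π), P.evidence ν π o ≠ 0 := by
  rw [mixture_eq_withDensity, ae_withDensity_iff (P.measurable_evidence_right ν π)]
  exact ae_of_all _ fun _ h => h

lemma obs_absolutelyContinuous (P : DecisionProblem 𝓜 D O) (M : 𝓜) (π : D) :
    P.obs M π ≪ P.baseKernel π :=
  P.obs_eq_withDensity M π ▸ withDensity_absolutelyContinuous _ _

lemma posterior_apply (P : DecisionProblem 𝓜 D O) (ν : PMF 𝓜) (π : D) (o : O) (M : 𝓜)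
    [Decidable (P.evidence ν π o ≠ 0 ∧ P.evidence ν π o ≠ ∞)] :
    P.posterior ν π o M = if P.evidence ν π o ≠ 0 ∧ P.evidence ν π o ≠ ∞ then
      ν M * P.likelihood M π o * (P.evidence ν π o)⁻¹ else ν M := by
  have he : P.evidence ν π o = ∑' M, ν M * P.likelihood M π o := by rw [tsum_fintype]; rfl
  simp only [he, posterior]
  split_ifs <;> rfl

lemma posterior_apply_of_ne (P : DecisionProblem 𝓜 D O) (ν : PMF 𝓜) (π : D) (o : O) (M : 𝓜)
    (h0 : P.evidence ν π o ≠ 0) (h1 : P.evidence ν π o ≠ ∞) :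
    P.posterior ν π o M = ν M * P.likelihood M π o * (P.evidence ν π o)⁻¹ := by
  classical
  rw [posterior_apply, if_pos ⟨h0, h1⟩]

/-- Zero evidence is no exception: every term of the sum then vanishes, so the conventional value of
the posterior is irrelevant. -/
lemma posterior_mul_evidence (P : DecisionProblem 𝓜 D O) (ν : PMF 𝓜) (π : D) (o : O) (M : 𝓜)
    (h1 : P.evidence ν π o ≠ ∞) :
    P.posterior ν π o M * P.evidence ν π o = ν M * P.likelihood M π o := by
  by_cases h0 : P.evidence ν π o = 0
  · rw [h0, mul_zero]
    rw [evidence, Finset.sum_eq_zero_iff] at h0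
    exact (h0 M (Finset.mem_univ M)).symm
  · rw [posterior_apply_of_ne P ν π o M h0 h1, mul_assoc, ENNReal.inv_mul_cancel h0 h1, mul_one]

lemma measurable_posterior (P : DecisionProblem 𝓜 D O) {Ω : Type*} [MeasurableSpace Ω]
    {ν : Ω → PMF 𝓜} (hν : ∀ M, Measurable fun x => ν x M) {π : Ω → D} (hπ : Measurable π)
    {o : Ω → O} (ho : Measurable o) (M : 𝓜) :
    Measurable fun x => P.posterior (ν x) (π x) (o x) M := by
  classical
  have hl : ∀ M, Measurable fun x => ν x M * P.likelihood M (π x) (o x) := fun M =>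
    (hν M).mul ((P.measurable_likelihood M).comp (hπ.prodMk ho))
  have he : Measurable fun x => P.evidence (ν x) (π x) (o x) :=
    Finset.measurable_fun_sum _ fun M _ => hl M
  simp_rw [posterior_apply]
  refine Measurable.ite ?_ ((hl M).mul he.inv) (hν M)
  exact (he (measurableSet_singleton 0)).compl.inter (he (measurableSet_singleton ∞)).compl

lemma measurable_posterior_right (P : DecisionProblem 𝓜 D O) (ν : PMF 𝓜) (π : D) (M : 𝓜) :
    Measurable fun o => P.posterior ν π o M :=
  P.measurable_posterior (fun _ => measurable_const) measurable_const measurable_id M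

lemma measurable_posterior_prod (P : DecisionProblem 𝓜 D O) (ν : PMF 𝓜) (M : 𝓜) :
    Measurable fun x : D × O => P.posterior ν x.1 x.2 M :=
  P.measurable_posterior (fun _ => measurable_const) measurable_fst measurable_snd M

/-- Bayes' rule: under the predictive law, weighting with the posterior probability of `M` gives the
law of the observation under `M`, weighted with the prior probability of `M`. -/
lemma withDensity_posterior (P : DecisionProblem 𝓜 D O) (ν : PMF 𝓜) (π : D) (M : 𝓜) :
    (P.mixture ν π).withDensity (fun o => P.posterior ν π o M) = ν M • P.obs M π := by
  rw [mixture_eq_withDensity, ← withDensity_mul _ (P.measurable_evidence_right ν π)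
    (P.measurable_posterior_right ν π M), P.obs_eq_withDensity M π,
    ← withDensity_smul _ (P.measurable_likelihood_right M π)]
  apply withDensity_congr_ae
  filter_upwards [P.ae_evidence_ne_top ν π] with o ho
  simp [mul_comm (P.evidence ν π o), P.posterior_mul_evidence ν π o M ho]

lemma lintegral_posterior_mul (P : DecisionProblem 𝓜 D O) (ν : PMF 𝓜) (π : D) (M : 𝓜)
    {f : O → ℝ≥0∞} (hf : Measurable f) :
    ∫⁻ o, P.posterior ν π o M * f o ∂(P.mixture ν π) = ν M * ∫⁻ o, f o ∂(P.obs M π) := by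
  rw [← smul_eq_mul, ← lintegral_smul_measure, ← withDensity_posterior,
    lintegral_withDensity_eq_lintegral_mul _ (P.measurable_posterior_right ν π M) hf]
  rfl

/-- Drawing the model and then the observation amounts to drawing the observation from the
predictive law and then the model from the posterior. -/
lemma lintegral_mixture_sum_posterior (P : DecisionProblem 𝓜 D O) (ν : PMF 𝓜) (π : D)
    {f : 𝓜 → O → ℝ≥0∞} (hf : ∀ M, Measurable (f M)) :
    ∫⁻ o, ∑ M, P.posterior ν π o M * f M o ∂(P.mixture ν π) =
      ∑ M, ν M * ∫⁻ o, f M o ∂(P.obs M π) := by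
  rw [lintegral_finsetSum (f := fun M o => P.posterior ν π o M * f M o) _
    fun M _ => (P.measurable_posterior_right ν π M).mul (hf M)]
  exact Finset.sum_congr rfl fun M _ => P.lintegral_posterior_mul ν π M (hf M)

/-! ### Information identities at a fixed decision. -/

lemma measurable_logLoss_posterior (P : DecisionProblem 𝓜 D O) (ν : PMF 𝓜) (π : D) (M : 𝓜) :
    Measurable fun o => logLoss (P.posterior ν π o M) :=
  measurable_logLoss.comp (P.measurable_posterior_right ν π M)

/-- The expected posterior divergence and the expected conditional entropy add up to the cross
entropy of the prior and the reference. -/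
lemma sum_lintegral_pmfKL_add [Nonempty 𝓜] (P : DecisionProblem 𝓜 D O) (ν ρ : PMF 𝓜) (π : D) :
    (∑ M, ν M * ∫⁻ o, pmfKL (P.posterior ν π o) ρ ∂(P.obs M π)) +
      ∑ M, ν M * ∫⁻ o, logLoss (P.posterior ν π o M) ∂(P.obs M π) =
      ∑ M, ν M * logLoss (ρ M) := by
  -- For an integrand independent of the observation, averaging the posterior returns the prior.
  have h := P.lintegral_mixture_sum_posterior ν π (f := fun M _ => logLoss (ρ M))
    fun _ => measurable_const
  have hm := measurable_pmfKL (P.measurable_posterior_right ν π)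
    (fun a => (measurable_const : Measurable fun _ : O => ρ a))
  rw [← lintegral_mixture, ← P.lintegral_mixture_sum_posterior ν π
    (P.measurable_logLoss_posterior ν π), ← lintegral_add_left hm]
  simp_rw [pmfKL_add_sum_logLoss]
  rw [h]
  simp

/-- Gibbs' inequality at each observation: under `μ` the posterior of `μ` is the best predictor.
Conditional entropy is therefore a minimum of functionals linear in `μ`, hence concave. -/
lemma sum_lintegral_logLoss_posterior_le (P : DecisionProblem 𝓜 D O) (μ ν : PMF 𝓜) (π : D) :
    ∑ M, μ M * ∫⁻ o, logLoss (P.posterior μ π o M) ∂(P.obs M π) ≤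
      ∑ M, μ M * ∫⁻ o, logLoss (P.posterior ν π o M) ∂(P.obs M π) := by
  rw [← P.lintegral_mixture_sum_posterior μ π (P.measurable_logLoss_posterior μ π),
    ← P.lintegral_mixture_sum_posterior μ π (P.measurable_logLoss_posterior ν π)]
  exact lintegral_mono fun o => sum_logLoss_self_le _ _

lemma sum_lintegral_logLoss_posterior_le_log_card [Nonempty 𝓜] (P : DecisionProblem 𝓜 D O)
    (μ : PMF 𝓜) (π : D) :
    ∑ M, μ M * ∫⁻ o, logLoss (P.posterior μ π o M) ∂(P.obs M π) ≤
      ENNReal.ofReal (Real.log (Fintype.card 𝓜)) := by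
  rw [← P.lintegral_mixture_sum_posterior μ π (P.measurable_logLoss_posterior μ π)]
  exact (lintegral_mono fun o => sum_logLoss_self_le_log_card _).trans (by simp)

/-- Bayes' rule for the information gain about a model of positive prior probability. -/
lemma klDiv_obs_mixture_add [Nonempty 𝓜] (P : DecisionProblem 𝓜 D O) (μ : PMF 𝓜) (π : D) {M : 𝓜}
    (hM : μ M ≠ 0) :
    InformationTheory.klDiv (P.obs M π) (P.mixture μ π) +
      ∫⁻ o, logLoss (P.posterior μ π o M) ∂(P.obs M π) = logLoss (μ M) := by
  have hMt := μ.apply_ne_top M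
  have hfin : ∫⁻ o, logLoss (P.posterior μ π o M) ∂(P.obs M π) ≠ ∞ := by
    have h := ne_top_of_le_ne_top ENNReal.ofReal_ne_top
      (P.sum_lintegral_logLoss_posterior_le_log_card μ π)
    exact fun h' => ENNReal.sum_ne_top.1 h M (Finset.mem_univ M) (by simp [h', hM])
  -- The density of a model against the mixture is posterior over prior.
  have hdens : P.obs M π =
      (P.mixture μ π).withDensity fun o => (μ M)⁻¹ * P.posterior μ π o M := by
    have := withDensity_smul (μ := P.mixture μ π) (μ M)⁻¹ (P.measurable_posterior_right μ π M)
    rw [withDensity_posterior, smul_smul, ENNReal.inv_mul_cancel hM hMt, one_smul] at this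
    exact this.symm
  -- A finite expected loss forces a positive posterior weight almost surely.
  have hpos : ∀ᵐ o ∂(P.obs M π), P.posterior μ π o M ≠ 0 := by
    filter_upwards [ae_lt_top (P.measurable_logLoss_posterior μ π M) hfin] with o ho
    exact ne_zero_of_logLoss_ne_top ho.ne
  have hint := integrable_toReal_of_lintegral_ne_top
    (P.measurable_logLoss_posterior μ π M).aemeasurable hfin
  have hlog : (fun o => (logLoss (μ M)).toReal - (logLoss (P.posterior μ π o M)).toReal)
      =ᵐ[P.obs M π] fun o => Real.log ((μ M)⁻¹ * P.posterior μ π o M).toReal := by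
    filter_upwards [hpos] with o ho
    rw [toReal_logLoss hM (μ.coe_le_one M), toReal_logLoss ho (PMF.coe_le_one _ M),
      ENNReal.toReal_mul, ENNReal.toReal_inv, Real.log_mul
        (inv_ne_zero (ENNReal.toReal_ne_zero.2 ⟨hM, hMt⟩))
        (ENNReal.toReal_ne_zero.2 ⟨ho, PMF.apply_ne_top _ M⟩), Real.log_inv]
    ring
  obtain ⟨h1, h2⟩ := klDiv_withDensity (P.obs M π) (P.mixture μ π) _
    ((P.measurable_posterior_right μ π M).const_mul _) hdens
    (((integrable_const _).sub hint).congr hlog)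
  rw [← ENNReal.toReal_eq_toReal_iff' (ENNReal.add_ne_top.2 ⟨h1, hfin⟩) (logLoss_ne_top hM),
    ENNReal.toReal_add h1 hfin, h2, ← integral_congr_ae hlog,
    integral_sub (integrable_const _) hint, integral_toReal
      (P.measurable_logLoss_posterior μ π M).aemeasurable
      (ae_lt_top (P.measurable_logLoss_posterior μ π M) hfin)]
  simp

end DecisionProblem

/-! ### The same identities averaged over the decision. -/

namespace DecisionProblem

variable {𝓜 D O : Type*} [Fintype 𝓜] [MeasurableSpace D] [MeasurableSpace O]
  [MeasurableSpace.CountableOrCountablyGenerated D O]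

/-- The expected logarithmic loss under `M` of the posterior of `ν`. -/
noncomputable def expLogLoss (P : DecisionProblem 𝓜 D O) (ν : PMF 𝓜) (M : 𝓜) (p : Measure D) :
    ℝ≥0∞ :=
  ∫⁻ π, ∫⁻ o, logLoss (P.posterior ν π o M) ∂(P.obs M π) ∂p

/-- The expected divergence of the posterior of `ν` from `ρ`. -/
noncomputable def infoGain (P : DecisionProblem 𝓜 D O) (ρ ν : PMF 𝓜) (p : Measure D) : ℝ≥0∞ :=
  ∑ M, ν M * ∫⁻ π, ∫⁻ o, pmfKL (P.posterior ν π o) ρ ∂(P.obs M π) ∂p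

lemma mair_eq (P : DecisionProblem 𝓜 D O) (ρ : PMF 𝓜) (η : ℝ) (p : Measure D) (ν : PMF 𝓜) :
    P.mair ρ η p ν = ((∑ M, ν M * P.expGap M p : ℝ≥0∞) : EReal) -
      ((ENNReal.ofReal (1 / η) * P.infoGain ρ ν p : ℝ≥0∞) : EReal) := rfl

lemma measurable_lintegral_logLoss (P : DecisionProblem 𝓜 D O) (ν : PMF 𝓜) (M : 𝓜) :
    Measurable fun π => ∫⁻ o, logLoss (P.posterior ν π o M) ∂(P.obs M π) :=
  (measurable_logLoss.comp (P.measurable_posterior_prod ν M)).lintegral_kernel_prod_right'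

lemma measurable_lintegral_pmfKL [Nonempty 𝓜] (P : DecisionProblem 𝓜 D O) (ρ ν : PMF 𝓜) (M : 𝓜) :
    Measurable fun π => ∫⁻ o, pmfKL (P.posterior ν π o) ρ ∂(P.obs M π) :=
  (measurable_pmfKL (P.measurable_posterior_prod ν)
    (fun a => (measurable_const : Measurable fun _ : D × O => ρ a))).lintegral_kernel_prod_right'

lemma sum_mul_expLogLoss (P : DecisionProblem 𝓜 D O) (μ ν : PMF 𝓜) (p : Measure D) :
    ∑ M, μ M * P.expLogLoss ν M p =
      ∫⁻ π, ∑ M, μ M * ∫⁻ o, logLoss (P.posterior ν π o M) ∂(P.obs M π) ∂p := by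
  rw [lintegral_finsetSum _ fun M _ => (P.measurable_lintegral_logLoss ν M).const_mul _]
  exact Finset.sum_congr rfl fun M _ =>
    (lintegral_const_mul _ (P.measurable_lintegral_logLoss ν M)).symm

/-- The right side is linear in `ν` and free of `p`, so the conditional entropy carries all the
nonlinearity of MAIR in the belief. The additive form avoids subtracting infinite values. -/
lemma infoGain_add_sum_expLogLoss [Nonempty 𝓜] (P : DecisionProblem 𝓜 D O) (ρ ν : PMF 𝓜)
    (p : Measure D) [IsProbabilityMeasure p] :
    P.infoGain ρ ν p + ∑ M, ν M * P.expLogLoss ν M p = ∑ M, ν M * logLoss (ρ M) := by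
  have h : P.infoGain ρ ν p =
      ∫⁻ π, ∑ M, ν M * ∫⁻ o, pmfKL (P.posterior ν π o) ρ ∂(P.obs M π) ∂p := by
    rw [lintegral_finsetSum _ fun M _ => (P.measurable_lintegral_pmfKL ρ ν M).const_mul _]
    exact Finset.sum_congr rfl fun M _ =>
      (lintegral_const_mul _ (P.measurable_lintegral_pmfKL ρ ν M)).symm
  rw [h, sum_mul_expLogLoss, ← lintegral_add_left
    (Finset.measurable_fun_sum _ fun M _ => (P.measurable_lintegral_pmfKL ρ ν M).const_mul _)]
  simp_rw [sum_lintegral_pmfKL_add]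
  simp

lemma sum_expLogLoss_le (P : DecisionProblem 𝓜 D O) (μ ν : PMF 𝓜) (p : Measure D) :
    ∑ M, μ M * P.expLogLoss μ M p ≤ ∑ M, μ M * P.expLogLoss ν M p := by
  rw [sum_mul_expLogLoss, sum_mul_expLogLoss]
  exact lintegral_mono fun π => P.sum_lintegral_logLoss_posterior_le μ ν π

lemma sum_expLogLoss_le_log_card [Nonempty 𝓜] (P : DecisionProblem 𝓜 D O) (μ : PMF 𝓜)
    (p : Measure D) [IsProbabilityMeasure p] :
    ∑ M, μ M * P.expLogLoss μ M p ≤ ENNReal.ofReal (Real.log (Fintype.card 𝓜)) := by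
  rw [sum_mul_expLogLoss]
  exact (lintegral_mono fun π => P.sum_lintegral_logLoss_posterior_le_log_card μ π).trans (by simp)

lemma infoGain_self_le [Nonempty 𝓜] (P : DecisionProblem 𝓜 D O) (ρ : PMF 𝓜)
    (p : Measure D) [IsProbabilityMeasure p] :
    P.infoGain ρ ρ p ≤ ENNReal.ofReal (Real.log (Fintype.card 𝓜)) :=
  (le_self_add.trans_eq (P.infoGain_add_sum_expLogLoss ρ ρ p)).trans
    (sum_logLoss_self_le_log_card ρ)

/-- The expected divergence of the models from their mixture is at most the information gain. -/
lemma sum_lintegral_klDiv_le_infoGain [Nonempty 𝓜] (P : DecisionProblem 𝓜 D O) (ρ μ : PMF 𝓜)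
    (p : Measure D) [IsProbabilityMeasure p] :
    ∑ M, μ M * ∫⁻ π, InformationTheory.klDiv (P.obs M π) (P.mixture μ π) ∂p ≤
      P.infoGain ρ μ p := by
  have hH := ne_top_of_le_ne_top ENNReal.ofReal_ne_top (P.sum_expLogLoss_le_log_card μ p)
  -- Adding the conditional entropy reduces the claim to entropy of `μ` at most cross entropy of `μ`
  -- and `ρ`.
  rw [← ENNReal.add_le_add_iff_right hH, infoGain_add_sum_expLogLoss, ← Finset.sum_add_distrib]
  refine le_trans (Finset.sum_le_sum fun M _ => ?_) (sum_logLoss_self_le μ ρ)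
  rw [← mul_add]
  by_cases hM : μ M = 0
  · simp [hM]
  gcongr
  rw [expLogLoss, ← lintegral_add_right _ (P.measurable_lintegral_logLoss μ M)]
  simp_rw [P.klDiv_obs_mixture_add μ _ hM]
  simp

end DecisionProblem

/-! ### Bounds on MAIR and comparison with the decision-estimation coefficient. -/

/-- An average is at most a supremum. Finite penalties on the support exclude `∞ - ∞` there: an
infinite gain makes the supremum `⊤`, and otherwise all the averaged terms are real. -/
lemma sum_sub_sum_le_iSup {α : Type*} [Fintype α] (μ : PMF α) (G K : α → ℝ≥0∞)
    (hK : ∀ a, μ a ≠ 0 → K a ≠ ∞) :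
    ((∑ a, μ a * G a : ℝ≥0∞) : EReal) - ((∑ a, μ a * K a : ℝ≥0∞) : EReal) ≤
      ⨆ a, (G a : EReal) - (K a : EReal) := by
  have hsup := le_iSup fun a => (G a : EReal) - (K a : EReal)
  generalize (⨆ a, (G a : EReal) - (K a : EReal)) = c at hsup ⊢
  obtain ⟨a₀, ha₀⟩ := μ.support_nonempty
  by_cases hG : ∃ a, μ a ≠ 0 ∧ G a = ∞
  · obtain ⟨a, ha, hGa⟩ := hG
    have := hsup a
    rw [hGa, EReal.coe_ennreal_top, EReal.top_sub (by simpa using hK a ha), top_le_iff] at this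
    rw [this]
    exact le_top
  push Not at hG
  have hx : ∀ a, μ a ≠ 0 →
      (G a : EReal) - (K a : EReal) = ((G a).toReal - (K a).toReal : ℝ) := fun a ha => by
    rw [← EReal.coe_ennreal_toReal (hG a ha), ← EReal.coe_ennreal_toReal (hK a ha), EReal.coe_sub]
  have hmul : ∀ F : α → ℝ≥0∞, (∀ a, μ a ≠ 0 → F a ≠ ∞) → ∀ a, μ a * F a ≠ ∞ := fun F hF a => by
    by_cases ha : μ a = 0
    · simp [ha]
    · exact ENNReal.mul_ne_top (μ.apply_ne_top a) (hF a ha)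
  rw [← EReal.coe_ennreal_toReal (ENNReal.sum_ne_top.2 fun a _ => hmul G hG a),
    ← EReal.coe_ennreal_toReal (ENNReal.sum_ne_top.2 fun a _ => hmul K hK a), ← EReal.coe_sub,
    ENNReal.toReal_sum fun a _ => hmul G hG a, ENNReal.toReal_sum fun a _ => hmul K hK a]
  induction c with
  | top => exact le_top
  | bot => exact absurd (hsup a₀) (by rw [hx a₀ ha₀, le_bot_iff]; exact EReal.coe_ne_bot _)
  | coe c =>
    rw [EReal.coe_le_coe_iff, ← Finset.sum_sub_distrib]
    calc ∑ a, ((μ a * G a).toReal - (μ a * K a).toReal)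
        ≤ ∑ a, (μ a).toReal * c := Finset.sum_le_sum fun a _ => by
          by_cases ha : μ a = 0
          · simp [ha]
          have h := hsup a
          rw [hx a ha, EReal.coe_le_coe_iff] at h
          rw [ENNReal.toReal_mul, ENNReal.toReal_mul, ← mul_sub]
          exact mul_le_mul_of_nonneg_left h ENNReal.toReal_nonneg
      _ = c := by rw [← Finset.sum_mul, sum_toReal_pmf_eq_one, one_mul]

namespace DecisionProblem

variable {𝓜 D O : Type*} [Fintype 𝓜] [MeasurableSpace D] [MeasurableSpace O]
  [MeasurableSpace.CountableOrCountablyGenerated D O]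

/-- The information gain is lowered to the mutual information before averaging. On the support of
`μ` the divergences are finite, being at most `-log μ(M)`. -/
lemma mair_le_iSup [Nonempty 𝓜] (P : DecisionProblem 𝓜 D O) (ρ μ : PMF 𝓜) (η : ℝ)
    (p : Measure D) [IsProbabilityMeasure p] :
    P.mair ρ η p μ ≤ ⨆ M : 𝓜, ((P.expGap M p : ℝ≥0∞) : EReal) -
      ((ENNReal.ofReal (1 / η) *
        ∫⁻ π, InformationTheory.klDiv (P.obs M π) (P.mixture μ π) ∂p : ℝ≥0∞) : EReal) := by
  refine le_trans ?_ (sum_sub_sum_le_iSup μ (fun M => P.expGap M p) (fun M =>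
    ENNReal.ofReal (1 / η) * ∫⁻ π, InformationTheory.klDiv (P.obs M π) (P.mixture μ π) ∂p)
    fun M hM => ENNReal.mul_ne_top ENNReal.ofReal_ne_top ?_)
  · rw [mair_eq]
    refine EReal.sub_le_sub le_rfl (EReal.coe_ennreal_le_coe_ennreal_iff.2 ?_)
    simp_rw [mul_left_comm (μ _) (ENNReal.ofReal (1 / η))]
    rw [← Finset.mul_sum]
    gcongr
    exact P.sum_lintegral_klDiv_le_infoGain ρ μ p
  · refine ne_top_of_le_ne_top (logLoss_ne_top hM) ?_
    calc ∫⁻ π, InformationTheory.klDiv (P.obs M π) (P.mixture μ π) ∂p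
        ≤ ∫⁻ _, logLoss (μ M) ∂p := lintegral_mono fun π =>
          le_self_add.trans_eq (P.klDiv_obs_mixture_add μ π hM)
      _ = logLoss (μ M) := by simp

/-- The value of MAIR at an optimal decision distribution is bounded by the decision-estimation
coefficient. -/
lemma mair_le_decKL [Nonempty 𝓜] (P : DecisionProblem 𝓜 D O) (ρ μ : PMF 𝓜) (η : ℝ)
    {v : EReal} (hv : ∀ p : ProbabilityMeasure D, v ≤ P.mair ρ η p μ) : v ≤ P.decKL η :=
  -- The belief itself supplies the weights of the reference mixture.
  le_iSup_of_le μ (le_iInf fun p => (hv p).trans (P.mair_le_iSup ρ μ η p))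

/-- A lower bound on MAIR when the belief equals the reference. -/
lemma neg_log_card_le_mair_self [Nonempty 𝓜] (P : DecisionProblem 𝓜 D O) (ρ : PMF 𝓜) {η : ℝ}
    (hη : 0 < η) (p : Measure D) [IsProbabilityMeasure p] :
    ((-(Real.log (Fintype.card 𝓜) / η) : ℝ) : EReal) ≤ P.mair ρ η p ρ := by
  have h : (ENNReal.ofReal (1 / η) * P.infoGain ρ ρ p) ≤
      ENNReal.ofReal (Real.log (Fintype.card 𝓜) / η) := by
    rw [← one_div_mul_eq_div _ (Real.log _), ENNReal.ofReal_mul (by positivity)]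
    gcongr
    exact P.infoGain_self_le ρ p
  rw [mair_eq, sub_eq_add_neg, ← zero_add ((-(Real.log (Fintype.card 𝓜) / η) : ℝ) : EReal)]
  refine add_le_add (EReal.coe_ennreal_nonneg _) ?_
  rw [EReal.coe_neg, EReal.neg_le_neg_iff]
  refine (EReal.coe_ennreal_le_coe_ennreal_iff.2 h).trans_eq ?_
  rw [EReal.coe_ennreal_ofReal, max_eq_left]
  have := Real.log_natCast_nonneg (Fintype.card 𝓜)
  positivity

/-- An upper bound on MAIR at a deterministic decision. -/
lemma mair_dirac_le (P : DecisionProblem 𝓜 D O) (ρ μ : PMF 𝓜) (η : ℝ) (π : D) :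
    P.mair ρ η (Measure.dirac π) μ ≤ ((∑ M, P.gap M π : ℝ) : EReal) := by
  have hnn : ∀ M, 0 ≤ P.gap M π := fun M => sub_nonneg.2 (P.reward_le_opt M π)
  have hg : ∀ M, P.expGap M (Measure.dirac π) = ENNReal.ofReal (P.gap M π) := fun M =>
    lintegral_dirac' π (measurable_const.sub (P.measurable_reward M)).ennreal_ofReal
  have h : ∑ M, μ M * P.expGap M (Measure.dirac π) ≤ ENNReal.ofReal (∑ M, P.gap M π) := by
    rw [ENNReal.ofReal_sum_of_nonneg fun M _ => hnn M]
    refine Finset.sum_le_sum fun M _ => ?_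
    rw [hg]
    exact mul_le_of_le_one_left' (μ.coe_le_one M)
  rw [mair_eq]
  refine EReal.sub_le_of_le_add ((EReal.coe_ennreal_le_coe_ennreal_iff.2 h).trans ?_)
  rw [EReal.coe_ennreal_ofReal, max_eq_left (Finset.sum_nonneg fun M _ => hnn M)]
  exact le_add_of_nonneg_right (EReal.coe_ennreal_nonneg _)

end DecisionProblem

/-! ### First-order optimality of the belief. -/

open Filter Topology

lemma add_le_add_of_coe_sub_le_coe_sub {x y z w : ℝ≥0∞} (hy : y ≠ ∞) (hw : w ≠ ∞)
    (h : (x : EReal) - (y : EReal) ≤ (z : EReal) - (w : EReal)) : x + w ≤ z + y := by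
  by_cases hz : z = ∞
  · simp [hz]
  lift y to NNReal using hy
  lift w to NNReal using hw
  lift z to NNReal using hz
  have hx : x ≠ ∞ := by
    rintro rfl
    rw [EReal.coe_ennreal_top, EReal.top_sub (by simp), top_le_iff] at h
    exact absurd h (EReal.coe_ne_top ((z : ℝ) - (w : ℝ)))
  lift x to NNReal using hx
  have h' : ((x : ℝ) - (y : ℝ)) ≤ ((z : ℝ) - (w : ℝ)) := EReal.coe_le_coe_iff.1 h
  norm_cast
  rw [← NNReal.coe_le_coe]
  push_cast
  linarith

/-- The algebra of the first-order condition, with `a = 1/η` and `δ = 1 - ε`. `G`, `J`, `H` are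
expected gap, information gain and conditional entropy at `μ`; `J'`, `H'` are the last two at the
perturbed belief. For the model `M`, `G'` is its expected gap, `E` its loss under the perturbed
posterior and `r` its loss under the reference. The common finite terms cancel, and so does the
factor `ε`. -/
lemma le_of_perturbation_le {δ ε a G G' J J' H H' E r : ℝ≥0∞} (hδε : δ + ε = 1) (hε : ε ≠ 0)
    (ha : a ≠ ∞) (hG : G ≠ ∞) (hJ : J ≠ ∞) (hH : H ≠ ∞)
    (hle : (δ * G + ε * G') + a * J ≤ G + a * J')
    (hJH : J' + H' = δ * (J + H) + ε * r) (hE : δ * H + ε * E ≤ H') :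
    G' + a * J + a * E ≤ G + a * r := by
  have hδt : δ ≠ ∞ := ne_top_of_le_ne_top ENNReal.one_ne_top (hδε ▸ le_self_add)
  have hεt : ε ≠ ∞ := ne_top_of_le_ne_top ENNReal.one_ne_top (hδε ▸ le_add_self)
  have hC : δ * G + a * (δ * J) + a * (δ * H) ≠ ∞ := by finiteness
  rw [← ENNReal.mul_le_mul_iff_right hε hεt, ← ENNReal.add_le_add_iff_left hC]
  calc δ * G + a * (δ * J) + a * (δ * H) + ε * (G' + a * J + a * E)
      = (δ * G + ε * G') + a * ((δ + ε) * J) + a * (δ * H + ε * E) := by ring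
    _ = (δ * G + ε * G') + a * J + a * (δ * H + ε * E) := by rw [hδε, one_mul]
    _ ≤ G + a * J' + a * H' := by gcongr
    _ = G + a * (J' + H') := by ring
    _ = (δ + ε) * G + a * (δ * (J + H) + ε * r) := by rw [hJH, hδε, one_mul]
    _ = δ * G + a * (δ * J) + a * (δ * H) + ε * (G + a * r) := by ring

namespace DecisionProblem

variable {𝓜 D O : Type*} [Fintype 𝓜] [MeasurableSpace D] [MeasurableSpace O]
  [MeasurableSpace.CountableOrCountablyGenerated D O]

/-- Bayes' formula is continuous where the limiting evidence is positive; the evidence is then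
eventually positive along the sequence too. -/
lemma tendsto_logLoss_posterior (P : DecisionProblem 𝓜 D O) {μ : PMF 𝓜} {ν : ℕ → PMF 𝓜}
    (hν : ∀ M, Tendsto (fun n => ν n M) atTop (𝓝 (μ M))) {π : D} {o : O}
    (h0 : P.evidence μ π o ≠ 0) (h1 : ∀ M, P.likelihood M π o ≠ ∞) (M : 𝓜) :
    Tendsto (fun n => logLoss (P.posterior (ν n) π o M)) atTop
      (𝓝 (logLoss (P.posterior μ π o M))) := by
  refine (continuous_logLoss.tendsto _).comp ?_
  have hfin : ∀ ν : PMF 𝓜, P.evidence ν π o ≠ ∞ := fun ν =>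
    ENNReal.sum_ne_top.2 fun M _ => ENNReal.mul_ne_top (ν.apply_ne_top M) (h1 M)
  have hl : ∀ M, Tendsto (fun n => ν n M * P.likelihood M π o) atTop
      (𝓝 (μ M * P.likelihood M π o)) := fun M =>
    ENNReal.Tendsto.mul_const (hν M) (.inr (h1 M))
  have he : Tendsto (fun n => P.evidence (ν n) π o) atTop (𝓝 (P.evidence μ π o)) :=
    tendsto_finsetSum _ fun M _ => hl M
  rw [P.posterior_apply_of_ne μ π o M h0 (hfin μ)]
  refine (ENNReal.Tendsto.mul (hl M) (.inr (ENNReal.inv_ne_top.2 h0)) he.inv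
    (.inr (ENNReal.mul_ne_top (μ.apply_ne_top M) (h1 M)))).congr' ?_
  filter_upwards [he.eventually_ne h0] with n hn
  exact (P.posterior_apply_of_ne (ν n) π o M hn (hfin _)).symm

/-- Lower semicontinuity of the expected logarithmic loss in the belief. -/
lemma expLogLoss_le_of_tendsto (P : DecisionProblem 𝓜 D O) {μ : PMF 𝓜} {ν : ℕ → PMF 𝓜}
    (hν : ∀ M, Tendsto (fun n => ν n M) atTop (𝓝 (μ M))) {M : 𝓜} {p : Measure D}
    (hB : ∀ᵐ π ∂p, P.obs M π ≪ P.mixture μ π) {b : ℝ≥0∞}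
    (hb : ∀ n, P.expLogLoss (ν n) M p ≤ b) : P.expLogLoss μ M p ≤ b := by
  calc P.expLogLoss μ M p
      ≤ ∫⁻ π, liminf (fun n => ∫⁻ o, logLoss (P.posterior (ν n) π o M) ∂(P.obs M π)) atTop ∂p := by
        refine lintegral_mono_ae ?_
        filter_upwards [hB] with π hπ
        -- Fatou's lemma is used twice, here over observations and below over decisions.
        refine le_trans (lintegral_mono_ae ?_)
          (lintegral_liminf_le fun n => P.measurable_logLoss_posterior (ν n) π M)
        -- Domination by the predictive law makes the evidence positive almost surely under `M`.
        filter_upwards [hπ.ae_le (P.ae_evidence_ne_zero μ π), ae_all_iff.2 fun M' =>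
          (P.obs_absolutelyContinuous M π).ae_le (P.ae_likelihood_ne_top M' π)] with o h0 h1
        exact (P.tendsto_logLoss_posterior hν h0 h1 M).liminf_eq.ge
    _ ≤ liminf (fun n => P.expLogLoss (ν n) M p) atTop :=
        lintegral_liminf_le fun n => P.measurable_lintegral_logLoss (ν n) M
    _ ≤ b := liminf_le_of_frequently_le' (Frequently.of_forall hb)

/-- The first-order optimality condition for a belief that maximizes MAIR, in the direction of the
model `M`. -/
lemma expGap_add_le_of_forall_mair_le [Nonempty 𝓜] (P : DecisionProblem 𝓜 D O) {ρ μ : PMF 𝓜}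
    {η : ℝ} (hη : 0 < η) {p : Measure D} [IsProbabilityMeasure p]
    (hmax : ∀ ν, P.mair ρ η p ν ≤ P.mair ρ η p μ)
    (hG : ∑ M, μ M * P.expGap M p ≠ ∞) (hJ : P.infoGain ρ μ p ≠ ∞) {M : 𝓜} (hρ : ρ M ≠ 0)
    (hB : ∀ᵐ π ∂p, P.obs M π ≪ P.mixture μ π) :
    P.expGap M p + ENNReal.ofReal (1 / η) * P.infoGain ρ μ p +
        ENNReal.ofReal (1 / η) * P.expLogLoss μ M p ≤
      ∑ M', μ M' * P.expGap M' p + ENNReal.ofReal (1 / η) * logLoss (ρ M) := by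
  have ha : ENNReal.ofReal (1 / η) ≠ ∞ := ENNReal.ofReal_ne_top
  have ha0 : ENNReal.ofReal (1 / η) ≠ 0 := by simpa using hη
  have hH : ∑ M', μ M' * P.expLogLoss μ M' p ≠ ∞ :=
    ne_top_of_le_ne_top ENNReal.ofReal_ne_top (P.sum_expLogLoss_le_log_card μ p)
  have hr := logLoss_ne_top hρ
  have key : ∀ (ε : ℝ≥0∞) (hε : ε ≤ 1), ε ≠ 0 →
      P.expGap M p + ENNReal.ofReal (1 / η) * P.infoGain ρ μ p +
        ENNReal.ofReal (1 / η) * P.expLogLoss (pmfMix ε hε μ (PMF.pure M)) M p ≤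
      ∑ M', μ M' * P.expGap M' p + ENNReal.ofReal (1 / η) * logLoss (ρ M) := by
    intro ε hε hε0
    have hεt : ε ≠ ∞ := ne_top_of_le_ne_top ENNReal.one_ne_top hε
    have hJH := P.infoGain_add_sum_expLogLoss ρ (pmfMix ε hε μ (PMF.pure M)) p
    rw [sum_pmfMix_pure ε hε μ M (fun M' => logLoss (ρ M')),
      ← P.infoGain_add_sum_expLogLoss ρ μ p] at hJH
    have hJ' : P.infoGain ρ (pmfMix ε hε μ (PMF.pure M)) p ≠ ∞ := by
      refine ne_top_of_le_ne_top ?_ (le_self_add.trans_eq hJH)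
      finiteness
    have hle := add_le_add_of_coe_sub_le_coe_sub (ENNReal.mul_ne_top ha hJ')
      (ENNReal.mul_ne_top ha hJ) (hmax (pmfMix ε hε μ (PMF.pure M)))
    rw [sum_pmfMix_pure ε hε μ M (fun M' => P.expGap M' p)] at hle
    refine le_of_perturbation_le (tsub_add_cancel_of_le hε) hε0 ha hG hJ hH hle hJH ?_
    rw [sum_pmfMix_pure ε hε μ M
      (fun M' => P.expLogLoss (pmfMix ε hε μ (PMF.pure M)) M' p)]
    -- The perturbed posterior competes as a predictor under the unperturbed belief `μ`.
    exact add_le_add (mul_le_mul' le_rfl (P.sum_expLogLoss_le μ _ p)) le_rfl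
  have he1 : ∀ n : ℕ, ((n + 1 : ℕ) : ℝ≥0∞)⁻¹ ≤ 1 := fun n => by
    rw [ENNReal.inv_le_one]
    exact_mod_cast Nat.le_add_left 1 n
  have he0 : ∀ n : ℕ, ((n + 1 : ℕ) : ℝ≥0∞)⁻¹ ≠ 0 := fun n =>
    ENNReal.inv_ne_zero.2 (ENNReal.natCast_ne_top _)
  have hlim : Tendsto (fun n : ℕ => ((n + 1 : ℕ) : ℝ≥0∞)⁻¹) atTop (𝓝 0) :=
    ENNReal.tendsto_inv_nat_nhds_zero.comp (tendsto_add_atTop_nat 1)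
  have hν : ∀ M', Tendsto (fun n => pmfMix _ (he1 n) μ (PMF.pure M) M') atTop (𝓝 (μ M')) := by
    intro M'
    have h1 : Tendsto (fun n : ℕ => 1 - ((n + 1 : ℕ) : ℝ≥0∞)⁻¹) atTop (𝓝 (1 - 0)) :=
      ENNReal.Tendsto.sub tendsto_const_nhds hlim (.inl ENNReal.one_ne_top)
    have h2 := (ENNReal.Tendsto.mul_const h1 (.inr (μ.apply_ne_top M'))).add
      (ENNReal.Tendsto.mul_const hlim (.inr ((PMF.pure M).apply_ne_top M')))
    rwa [tsub_zero, one_mul, zero_mul, add_zero] at h2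
  set B := ∑ M', μ M' * P.expGap M' p + ENNReal.ofReal (1 / η) * logLoss (ρ M)
  set A := P.expGap M p + ENNReal.ofReal (1 / η) * P.infoGain ρ μ p
  have hBfin : B ≠ ∞ := by finiteness
  -- The case `ε = 1` already gives this, which makes the subtraction `B - A` exact.
  have hAB : A ≤ B := le_self_add.trans (key 1 le_rfl one_ne_zero)
  have hA : A ≠ ∞ := ne_top_of_le_ne_top hBfin hAB
  have hb : P.expLogLoss μ M p ≤ (B - A) / ENNReal.ofReal (1 / η) := by
    refine P.expLogLoss_le_of_tendsto hν hB fun n => ?_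
    rw [ENNReal.le_div_iff_mul_le (.inl ha0) (.inl ha), mul_comm]
    exact ENNReal.le_sub_of_add_le_left hA (key _ (he1 n) (he0 n))
  rw [ENNReal.le_div_iff_mul_le (.inl ha0) (.inl ha), mul_comm] at hb
  calc A + ENNReal.ofReal (1 / η) * P.expLogLoss μ M p ≤ A + (B - A) := by gcongr
    _ = B := add_tsub_cancel_of_le hAB

end DecisionProblem

/-! ### Consequences of the saddle point in one round. -/

lemma ne_top_of_coe_sub_coe_ne {x y : ℝ≥0∞} (hb : (x : EReal) - (y : EReal) ≠ ⊥)
    (ht : (x : EReal) - (y : EReal) ≠ ⊤) : x ≠ ∞ ∧ y ≠ ∞ := by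
  have hy : y ≠ ∞ := by
    rintro rfl
    simp at hb
  refine ⟨?_, hy⟩
  rintro rfl
  rw [EReal.coe_ennreal_top, EReal.top_sub (by simpa using hy)] at ht
  exact ht rfl

lemma toReal_coe_sub_coe {x y : ℝ≥0∞} (hx : x ≠ ∞) (hy : y ≠ ∞) :
    ((x : EReal) - (y : EReal)).toReal = x.toReal - y.toReal := by
  rw [← EReal.coe_ennreal_toReal hx, ← EReal.coe_ennreal_toReal hy, ← EReal.coe_sub,
    EReal.toReal_coe]

namespace DecisionProblem

variable {𝓜 D O : Type*} [Fintype 𝓜] [MeasurableSpace D] [MeasurableSpace O]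
  [MeasurableSpace.CountableOrCountablyGenerated D O]

section SaddlePoint

variable {P : DecisionProblem 𝓜 D O} {ρ μ : PMF 𝓜} {η : ℝ} {p : Measure D}

/-- The competitor is the point mass at `π`. -/
lemma mair_le_of_isSaddlePointOn
    (hs : IsSaddlePointOn {p : Measure D | IsProbabilityMeasure p} (Set.univ : Set (PMF 𝓜))
      (fun p μ => P.mair ρ η p μ) p μ) (π : D) :
    P.mair ρ η p μ ≤ ((∑ M, P.gap M π : ℝ) : EReal) :=
  (hs (Measure.dirac π) Measure.dirac.isProbabilityMeasure μ trivial).trans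
    (P.mair_dirac_le ρ μ η π)

lemma sum_expGap_ne_top_and_infoGain_ne_top (hη : 0 < η)
    (h : P.mair ρ η p μ ≠ ⊥ ∧ P.mair ρ η p μ ≠ ⊤) :
    ∑ M, μ M * P.expGap M p ≠ ∞ ∧ P.infoGain ρ μ p ≠ ∞ := by
  rw [mair_eq] at h
  obtain ⟨h1, h2⟩ := ne_top_of_coe_sub_coe_ne h.1 h.2
  refine ⟨h1, fun h' => h2 ?_⟩
  rw [h', ENNReal.mul_top (by simpa using hη)]

lemma toReal_mair (hη : 0 < η) (h : P.mair ρ η p μ ≠ ⊥ ∧ P.mair ρ η p μ ≠ ⊤) :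
    (P.mair ρ η p μ).toReal =
      (∑ M, μ M * P.expGap M p).toReal - 1 / η * (P.infoGain ρ μ p).toReal := by
  obtain ⟨h1, h2⟩ := sum_expGap_ne_top_and_infoGain_ne_top hη h
  rw [mair_eq, toReal_coe_sub_coe h1 (ENNReal.mul_ne_top ENNReal.ofReal_ne_top h2),
    ENNReal.toReal_mul, ENNReal.toReal_ofReal (by positivity)]

variable [Nonempty 𝓜] [IsProbabilityMeasure p]

/-- The competing belief is the reference `ρ` itself. -/
lemma neg_log_card_le_mair_of_isSaddlePointOn (hη : 0 < η)
    (hs : IsSaddlePointOn {p : Measure D | IsProbabilityMeasure p} (Set.univ : Set (PMF 𝓜))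
      (fun p μ => P.mair ρ η p μ) p μ) :
    ((-(Real.log (Fintype.card 𝓜) / η) : ℝ) : EReal) ≤ P.mair ρ η p μ :=
  (P.neg_log_card_le_mair_self ρ hη p).trans (hs p ‹_› ρ trivial)

lemma mair_finite_of_isSaddlePointOn (hη : 0 < η)
    (hs : IsSaddlePointOn {p : Measure D | IsProbabilityMeasure p} (Set.univ : Set (PMF 𝓜))
      (fun p μ => P.mair ρ η p μ) p μ) : P.mair ρ η p μ ≠ ⊥ ∧ P.mair ρ η p μ ≠ ⊤ :=
  ⟨fun h => by simpa [h] using neg_log_card_le_mair_of_isSaddlePointOn hη hs,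
    fun h => by
      have := mair_le_of_isSaddlePointOn hs (P.opt (Classical.arbitrary 𝓜))
      rw [h, top_le_iff] at this
      exact EReal.coe_ne_top _ this⟩

/-- The regret of one round and the logarithmic loss of the true model after it are controlled by
the value of MAIR and the logarithmic loss before it. -/
lemma expGap_add_expLogLoss_le (hη : 0 < η)
    (hs : IsSaddlePointOn {p : Measure D | IsProbabilityMeasure p} (Set.univ : Set (PMF 𝓜))
      (fun p μ => P.mair ρ η p μ) p μ) {M : 𝓜} (hρ : logLoss (ρ M) ≠ ∞)
    (hB : ∀ᵐ π ∂p, P.obs M π ≪ P.mixture μ π) :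
    P.expGap M p + ENNReal.ofReal (1 / η) * P.expLogLoss μ M p ≤
      ENNReal.ofReal ((P.mair ρ η p μ).toReal + 1 / η * (logLoss (ρ M)).toReal) ∧
    0 ≤ (P.mair ρ η p μ).toReal + 1 / η * (logLoss (ρ M)).toReal := by
  have hfin := mair_finite_of_isSaddlePointOn hη hs
  obtain ⟨hG, hJ⟩ := sum_expGap_ne_top_and_infoGain_ne_top hη hfin
  have h := P.expGap_add_le_of_forall_mair_le hη (fun ν => hs p ‹_› ν trivial) hG hJ
    (ne_zero_of_logLoss_ne_top hρ) hB
  have hR : ∑ M', μ M' * P.expGap M' p + ENNReal.ofReal (1 / η) * logLoss (ρ M) ≠ ∞ := by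
    finiteness
  rw [add_right_comm] at h
  have hX : P.expGap M p + ENNReal.ofReal (1 / η) * P.expLogLoss μ M p ≠ ∞ :=
    ne_top_of_le_ne_top hR (le_self_add.trans h)
  have hη' : 0 ≤ 1 / η := by positivity
  have h' := ENNReal.toReal_mono hR h
  rw [ENNReal.toReal_add hX (by finiteness), ENNReal.toReal_add hG (by finiteness),
    ENNReal.toReal_mul, ENNReal.toReal_mul, ENNReal.toReal_ofReal hη'] at h'
  have h'' : (P.expGap M p + ENNReal.ofReal (1 / η) * P.expLogLoss μ M p).toReal ≤
      (P.mair ρ η p μ).toReal + 1 / η * (logLoss (ρ M)).toReal := by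
    rw [toReal_mair hη hfin]
    linarith
  exact ⟨(ENNReal.le_ofReal_iff_toReal_le hX (ENNReal.toReal_nonneg.trans h'')).2 h'',
    ENNReal.toReal_nonneg.trans h''⟩

end SaddlePoint

end DecisionProblem

/-! ### Laws of histories and measurability. -/

namespace BeliefAlgorithm

variable {𝓜 D O : Type*} [MeasurableSpace D] [MeasurableSpace O]

lemma measurable_snoc (t : ℕ) : Measurable fun x : Hist D O t × (D × O) =>
    (Fin.snoc (α := fun _ => D × O) x.1 x.2 : Hist D O (t + 1)) := by
  refine measurable_pi_iff.2 fun i => ?_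
  refine Fin.lastCases ?_ (fun j => ?_) i
  · simpa using measurable_snd
  · simp only [Fin.snoc_castSucc]
    exact (measurable_pi_apply j).comp measurable_fst

lemma measurable_init (t : ℕ) :
    Measurable fun h : Hist D O (t + 1) => (Fin.init h : Hist D O t) :=
  measurable_pi_iff.2 fun _ => measurable_pi_apply _

instance isProbabilityMeasure_law (A : BeliefAlgorithm 𝓜 D O) (P : DecisionProblem 𝓜 D O)
    (Mstar : 𝓜) (t : ℕ) : IsProbabilityMeasure (A.law P Mstar t) := by
  induction t with
  | zero => rw [law]; infer_instance
  | succ t ih =>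
    rw [law]
    exact Measure.isProbabilityMeasure_map (measurable_snoc t).aemeasurable

lemma measurePreserving_init (A : BeliefAlgorithm 𝓜 D O) (P : DecisionProblem 𝓜 D O)
    (Mstar : 𝓜) (t : ℕ) :
    MeasurePreserving (fun h : Hist D O (t + 1) => (Fin.init h : Hist D O t))
      (A.law P Mstar (t + 1)) (A.law P Mstar t) := by
  refine ⟨measurable_init t, ?_⟩
  rw [law, Measure.map_map (measurable_init t) (measurable_snoc t)]
  have : (fun h : Hist D O (t + 1) => (Fin.init h : Hist D O t)) ∘
      (fun x : Hist D O t × (D × O) => (Fin.snoc (α := fun _ => D × O) x.1 x.2 : Hist D O (t + 1)))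
      = Prod.fst := by
    ext1 x
    exact Fin.init_snoc (α := fun _ => D × O) x.2 x.1
  rw [this]
  exact Measure.fst_compProd _ _

lemma lintegral_law_succ (A : BeliefAlgorithm 𝓜 D O) (P : DecisionProblem 𝓜 D O)
    (Mstar : 𝓜) (t : ℕ) {f : Hist D O (t + 1) → ℝ≥0∞} (hf : Measurable f) :
    ∫⁻ h, f h ∂(A.law P Mstar (t + 1)) =
      ∫⁻ h, ∫⁻ π, ∫⁻ o, f (Fin.snoc (α := fun _ => D × O) h (π, o)) ∂(P.obs Mstar π)
        ∂(A.policy t h) ∂(A.law P Mstar t) := by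
  rw [law, lintegral_map hf (measurable_snoc t)]
  refine (Measure.lintegral_compProd (hf.comp (measurable_snoc t))).trans ?_
  exact lintegral_congr fun h => Kernel.lintegral_compProd _ _ _
    ((hf.comp (measurable_snoc t)).comp measurable_prodMk_left)

lemma cumRegret_succ (P : DecisionProblem 𝓜 D O) (M : 𝓜) {t : ℕ} (h : Hist D O (t + 1)) :
    P.cumRegret M h = P.cumRegret M (Fin.init h : Hist D O t) + P.gap M (h (Fin.last t)).1 :=
  Fin.sum_univ_castSucc _

variable [Fintype 𝓜]

lemma measurable_sum_expGap (A : BeliefAlgorithm 𝓜 D O) (P : DecisionProblem 𝓜 D O) (t : ℕ) :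
    Measurable fun h => ∑ M, A.belief t h M * P.expGap M (A.policy t h) :=
  Finset.measurable_fun_sum _ fun M _ => (A.measurable_belief t M).mul
    (Measurable.lintegral_kernel
      (measurable_const.sub (P.measurable_reward M)).ennreal_ofReal)

variable [Nonempty 𝓜] [MeasurableSpace.CountableOrCountablyGenerated D O]

lemma measurable_ref (A : BeliefAlgorithm 𝓜 D O) (P : DecisionProblem 𝓜 D O) (t : ℕ) (M : 𝓜) :
    Measurable fun h => A.ref P t h M := by
  cases t with
  | zero => exact measurable_const
  | succ t =>
    exact P.measurable_posterior (fun M => (A.measurable_belief t M).comp (measurable_init t))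
      (measurable_fst.comp (measurable_pi_apply _)) (measurable_snd.comp (measurable_pi_apply _)) M

lemma measurable_infoGain (A : BeliefAlgorithm 𝓜 D O) (P : DecisionProblem 𝓜 D O) (t : ℕ) :
    Measurable fun h => P.infoGain (A.ref P t h) (A.belief t h) (A.policy t h) := by
  refine Finset.measurable_fun_sum _ fun M _ => (A.measurable_belief t M).mul ?_
  have h1 : Measurable fun x : (Hist D O t × D) × O =>
      pmfKL (P.posterior (A.belief t x.1.1) x.1.2 x.2) (A.ref P t x.1.1) :=
    measurable_pmfKL (P.measurable_posterior (fun M => (A.measurable_belief t M).comp (by fun_prop))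
      (by fun_prop) (by fun_prop)) fun M => (A.measurable_ref P t M).comp (by fun_prop)
  have h2 : Measurable fun x : Hist D O t × D =>
      ∫⁻ o, pmfKL (P.posterior (A.belief t x.1) x.2 o) (A.ref P t x.1)
        ∂(Kernel.prodMkLeft (Hist D O t) (P.obs M) x) := h1.lintegral_kernel_prod_right'
  exact h2.lintegral_kernel_prod_right'

/-! ### The potential argument. -/

section Round

variable {A : BeliefAlgorithm 𝓜 D O} {P : DecisionProblem 𝓜 D O} {Mstar : 𝓜} {η : ℝ} {t : ℕ}

/-- The saddle point condition of a single round. -/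
def IsSaddleAt (A : BeliefAlgorithm 𝓜 D O) (P : DecisionProblem 𝓜 D O) (η : ℝ) (t : ℕ)
    (h : Hist D O t) : Prop :=
  IsSaddlePointOn {p : Measure D | IsProbabilityMeasure p} (Set.univ : Set (PMF 𝓜))
    (fun p μ => P.mair (A.ref P t h) η p μ) (A.policy t h) (A.belief t h)

/-- The saddle point confines the value to a fixed bounded interval; any decision could replace
`P.opt Mstar` in its upper end. -/
lemma integrable_mairAt (hη : 0 < η) (hs : ∀ᵐ h ∂(A.law P Mstar t), A.IsSaddleAt P η t h) :
    Integrable (fun h => (A.mairAt P η h).toReal) (A.law P Mstar t) := by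
  have hmeas : AEStronglyMeasurable (fun h => (A.mairAt P η h).toReal) (A.law P Mstar t) := by
    refine (((A.measurable_sum_expGap P t).ennreal_toReal.sub
      ((A.measurable_infoGain P t).ennreal_toReal.const_mul (1 / η))).aestronglyMeasurable).congr ?_
    filter_upwards [hs] with h hh
    exact (DecisionProblem.toReal_mair hη
      (DecisionProblem.mair_finite_of_isSaddlePointOn hη hh)).symm
  refine Integrable.of_mem_Icc (-(Real.log (Fintype.card 𝓜) / η))
    (∑ M, P.gap M (P.opt Mstar)) hmeas.aemeasurable ?_
  filter_upwards [hs] with h hh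
  have hf := DecisionProblem.mair_finite_of_isSaddlePointOn hη hh
  have h1 := DecisionProblem.neg_log_card_le_mair_of_isSaddlePointOn hη hh
  have h2 := DecisionProblem.mair_le_of_isSaddlePointOn hh (P.opt Mstar)
  rw [← EReal.coe_toReal hf.2 hf.1, EReal.coe_le_coe_iff] at h1 h2
  exact ⟨h1, h2⟩

/-- One round of the potential argument. -/
lemma round_bound (hη : 0 < η) (hs : ∀ᵐ h ∂(A.law P Mstar t), A.IsSaddleAt P η t h)
    (hB : ∀ᵐ h ∂(A.law P Mstar t), ∀ᵐ π ∂(A.policy t h),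
      P.obs Mstar π ≪ P.mixture (A.belief t h) π)
    (hl : ∀ᵐ h ∂(A.law P Mstar t), logLoss (A.ref P t h Mstar) ≠ ∞)
    (hli : Integrable (fun h => (logLoss (A.ref P t h Mstar)).toReal) (A.law P Mstar t)) :
    Integrable (fun h => P.gap Mstar (h (Fin.last t)).1) (A.law P Mstar (t + 1)) ∧
    (∀ᵐ h ∂(A.law P Mstar (t + 1)), logLoss (A.ref P (t + 1) h Mstar) ≠ ∞) ∧
    Integrable (fun h => (logLoss (A.ref P (t + 1) h Mstar)).toReal) (A.law P Mstar (t + 1)) ∧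
    ∫ h, P.gap Mstar (h (Fin.last t)).1 ∂(A.law P Mstar (t + 1)) +
        1 / η * ∫ h, (logLoss (A.ref P (t + 1) h Mstar)).toReal ∂(A.law P Mstar (t + 1)) ≤
      ∫ h, (A.mairAt P η h).toReal ∂(A.law P Mstar t) +
        1 / η * ∫ h, (logLoss (A.ref P t h Mstar)).toReal ∂(A.law P Mstar t) := by
  have hη' : 0 < 1 / η := by positivity
  have ha0 : ENNReal.ofReal (1 / η) ≠ 0 := by simpa using hη
  have hgm : Measurable fun h : Hist D O (t + 1) => P.gap Mstar (h (Fin.last t)).1 :=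
    (measurable_const.sub (P.measurable_reward Mstar)).comp
      (measurable_fst.comp (measurable_pi_apply _))
  have hlm : Measurable fun h => logLoss (A.ref P (t + 1) h Mstar) :=
    measurable_logLoss.comp (A.measurable_ref P (t + 1) Mstar)
  have hbound : ∀ᵐ h ∂(A.law P Mstar t),
      P.expGap Mstar (A.policy t h) +
          ENNReal.ofReal (1 / η) * P.expLogLoss (A.belief t h) Mstar (A.policy t h) ≤
        ENNReal.ofReal ((A.mairAt P η h).toReal + 1 / η * (logLoss (A.ref P t h Mstar)).toReal) ∧
      0 ≤ (A.mairAt P η h).toReal + 1 / η * (logLoss (A.ref P t h Mstar)).toReal := by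
    filter_upwards [hs, hB, hl] with h h1 h2 h3
    exact DecisionProblem.expGap_add_expLogLoss_le hη h1 h3 h2
  have hvi := integrable_mairAt hη hs
  have hint : Integrable (fun h => (A.mairAt P η h).toReal +
      1 / η * (logLoss (A.ref P t h Mstar)).toReal) (A.law P Mstar t) :=
    hvi.add (hli.const_mul (1 / η))
  -- Working with lower integrals yields both integrability claims from finiteness of the right
  -- side.
  have hX : ∫⁻ h, ENNReal.ofReal (P.gap Mstar (h (Fin.last t)).1) +
      ENNReal.ofReal (1 / η) * logLoss (A.ref P (t + 1) h Mstar) ∂(A.law P Mstar (t + 1)) ≤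
      ENNReal.ofReal (∫ h, (A.mairAt P η h).toReal +
        1 / η * (logLoss (A.ref P t h Mstar)).toReal ∂(A.law P Mstar t)) := by
    rw [ofReal_integral_eq_lintegral_ofReal hint (hbound.mono fun h hh => hh.2)]
    refine (A.lintegral_law_succ P Mstar t (hgm.ennreal_ofReal.add (hlm.const_mul _))).trans_le ?_
    refine lintegral_mono_ae (hbound.mono fun h hh => le_trans (le_of_eq ?_) hh.1)
    simp only [Pi.add_apply, ref, Fin.init_snoc, Fin.snoc_last]
    rw [DecisionProblem.expGap, DecisionProblem.expLogLoss,
      ← lintegral_const_mul _ (P.measurable_lintegral_logLoss _ _), ← lintegral_add_right _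
        ((P.measurable_lintegral_logLoss _ _).const_mul _)]
    refine lintegral_congr fun π => ?_
    rw [lintegral_add_left measurable_const,
      lintegral_const_mul _ (P.measurable_logLoss_posterior _ _ _)]
    simp
  rw [lintegral_add_left hgm.ennreal_ofReal, lintegral_const_mul _ hlm] at hX
  have hsum := ne_top_of_le_ne_top ENNReal.ofReal_ne_top hX
  obtain ⟨hgf, hlf⟩ := ENNReal.add_ne_top.1 hsum
  replace hlf : ∫⁻ h, logLoss (A.ref P (t + 1) h Mstar) ∂(A.law P Mstar (t + 1)) ≠ ∞ :=
    fun h => hlf (by rw [h, ENNReal.mul_top ha0])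
  have hgnn : ∀ h : Hist D O (t + 1), 0 ≤ P.gap Mstar (h (Fin.last t)).1 := fun h =>
    sub_nonneg.2 (P.reward_le_opt Mstar _)
  have hlae := ae_lt_top hlm hlf
  refine ⟨(lintegral_ofReal_ne_top_iff_integrable hgm.aestronglyMeasurable
    (ae_of_all _ hgnn)).1 hgf, hlae.mono fun _ h => h.ne,
    integrable_toReal_of_lintegral_ne_top hlm.aemeasurable hlf, ?_⟩
  rw [integral_toReal hlm.aemeasurable hlae, integral_eq_lintegral_of_nonneg_ae (ae_of_all _ hgnn)
    hgm.aestronglyMeasurable, ← integral_const_mul, ← integral_add hvi (hli.const_mul _)]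
  have h := ENNReal.toReal_mono ENNReal.ofReal_ne_top hX
  rwa [ENNReal.toReal_add hgf (ENNReal.mul_ne_top ENNReal.ofReal_ne_top hlf), ENNReal.toReal_mul,
    ENNReal.toReal_ofReal hη'.le, ENNReal.toReal_ofReal
      (integral_nonneg_of_ae (hbound.mono fun h hh => hh.2))] at h

end Round

lemma mairAt_le_decKL {A : BeliefAlgorithm 𝓜 D O} {P : DecisionProblem 𝓜 D O} {η : ℝ} {t : ℕ}
    {h : Hist D O t} (hs : A.IsSaddleAt P η t h) : A.mairAt P η h ≤ P.decKL η :=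
  P.mair_le_decKL _ _ η fun p => hs p p.2 _ trivial

/-- The invariant of the regret analysis after `T` rounds. -/
lemma regret_potential_bound (A : BeliefAlgorithm 𝓜 D O) (P : DecisionProblem 𝓜 D O) (Mstar : 𝓜)
    {η : ℝ} (hη : 0 < η) (T : ℕ) (hA : A.IsMAMS P Mstar η T) (hB : A.BayesApplies P Mstar T) :
    Integrable (fun h => P.cumRegret Mstar h) (A.law P Mstar T) ∧
    (∀ᵐ h ∂(A.law P Mstar T), ∀ t : Fin T, A.IsSaddleAt P η t (past h t)) ∧
    Integrable (fun h => ∑ t : Fin T, (A.mairAt P η (past h t)).toReal) (A.law P Mstar T) ∧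
    (∀ᵐ h ∂(A.law P Mstar T), logLoss (A.ref P T h Mstar) ≠ ∞) ∧
    Integrable (fun h => (logLoss (A.ref P T h Mstar)).toReal) (A.law P Mstar T) ∧
    ∫ h, P.cumRegret Mstar h ∂(A.law P Mstar T) +
        1 / η * ∫ h, (logLoss (A.ref P T h Mstar)).toReal ∂(A.law P Mstar T) ≤
      Real.log (Fintype.card 𝓜) / η +
        ∫ h, ∑ t : Fin T, (A.mairAt P η (past h t)).toReal ∂(A.law P Mstar T) := by
  induction T with
  | zero =>
    -- The uniform reference gives the initial potential `log |𝓜|`.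
    have hlog : ∀ h, logLoss (A.ref P 0 h Mstar) =
        ENNReal.ofReal (Real.log (Fintype.card 𝓜)) := fun h => logLoss_uniform Mstar
    have hnn := Real.log_natCast_nonneg (Fintype.card 𝓜)
    simp [DecisionProblem.cumRegret, hlog, ENNReal.toReal_ofReal hnn, div_eq_inv_mul]
  | succ T ih =>
    obtain ⟨h1, h2, h3, h4, h5, h6⟩ := ih (fun t ht => hA t (ht.trans T.lt_succ_self))
      (fun t ht => hB t (ht.trans T.lt_succ_self))
    have hs := hA T T.lt_succ_self
    obtain ⟨r1, r2, r3, r4⟩ := round_bound hη hs (hB T T.lt_succ_self) h4 h5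
    have hmp := A.measurePreserving_init P Mstar T
    have hv := integrable_mairAt hη hs
    have hsplit : ∀ h : Hist D O (T + 1), ∑ t : Fin (T + 1), (A.mairAt P η (past h t)).toReal =
        ∑ t : Fin T, (A.mairAt P η (past (Fin.init h : Hist D O T) t)).toReal +
          (A.mairAt P η (Fin.init h : Hist D O T)).toReal := fun h => Fin.sum_univ_castSucc _
    -- Dropping the last round preserves the law, so integrals over the first `T` rounds carry over.
    have hcomp : ∀ {g : Hist D O T → ℝ}, Integrable g (A.law P Mstar T) →
        Integrable (fun h : Hist D O (T + 1) => g (Fin.init h)) (A.law P Mstar (T + 1)) ∧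
        ∫ h : Hist D O (T + 1), g (Fin.init h) ∂(A.law P Mstar (T + 1)) =
          ∫ h, g h ∂(A.law P Mstar T) := fun {g} hg => by
      refine ⟨hmp.integrable_comp_of_integrable hg, ?_⟩
      conv_rhs => rw [← hmp.map_eq]
      rw [integral_map hmp.measurable.aemeasurable (hmp.map_eq.symm ▸ hg.aestronglyMeasurable)]
    simp_rw [cumRegret_succ, hsplit]
    obtain ⟨c1, c1'⟩ := hcomp h1
    obtain ⟨c3, c3'⟩ := hcomp h3
    obtain ⟨cv, cv'⟩ := hcomp hv
    refine ⟨c1.add r1, ?_, c3.add cv, r2, r3, ?_⟩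
    · filter_upwards [hmp.quasiMeasurePreserving.ae h2, hmp.quasiMeasurePreserving.ae hs]
        with h ha hb t
      exact Fin.lastCases (motive := fun t => A.IsSaddleAt P η t (past h t)) hb ha t
    · rw [integral_add c1 r1, integral_add c3 cv, c1', c3', cv']
      linarith

end BeliefAlgorithm

end MAMS

/-! ### The regret bound. -/

theorem theorem7p2 {𝓜 D O : Type*} [Fintype 𝓜] [Nonempty 𝓜] [MeasurableSpace D]
    [MeasurableSpace O] [MeasurableSpace.CountableOrCountablyGenerated D O]
    (P : MAMS.DecisionProblem 𝓜 D O) (Mstar : 𝓜) (η : ℝ) (hη : 0 < η) (T : ℕ)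
    (A : MAMS.BeliefAlgorithm 𝓜 D O) (hA : A.IsMAMS P Mstar η T)
    (hBayes : A.BayesApplies P Mstar T) :
    Integrable (fun h => P.cumRegret Mstar h) (A.law P Mstar T) ∧
    (∀ᵐ h ∂(A.law P Mstar T), ∀ t : Fin T,
      A.mairAt P η (MAMS.past h t) ≠ ⊥ ∧ A.mairAt P η (MAMS.past h t) ≠ ⊤) ∧
    Integrable (fun h => ∑ t : Fin T, (A.mairAt P η (MAMS.past h t)).toReal) (A.law P Mstar T) ∧
    ∫ h, P.cumRegret Mstar h ∂(A.law P Mstar T) ≤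
      Real.log (Fintype.card 𝓜) / η +
        ∫ h, ∑ t : Fin T, (A.mairAt P η (MAMS.past h t)).toReal ∂(A.law P Mstar T) ∧
    ((Real.log (Fintype.card 𝓜) / η +
        ∫ h, ∑ t : Fin T, (A.mairAt P η (MAMS.past h t)).toReal ∂(A.law P Mstar T) : ℝ) : EReal) ≤
      ((Real.log (Fintype.card 𝓜) / η : ℝ) : EReal) + P.decKL η * (T : EReal) := by
  obtain ⟨h1, h2, h3, h4, h5, h6⟩ := A.regret_potential_bound P Mstar hη T hA hBayes
  refine ⟨h1, ?_, h3, ?_, ?_⟩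
  · filter_upwards [h2] with h hh t
    exact MAMS.DecisionProblem.mair_finite_of_isSaddlePointOn hη (hh t)
  -- The final potential is nonnegative and is dropped.
  · have h7 : 0 ≤ 1 / η * ∫ h, (MAMS.logLoss (A.ref P T h Mstar)).toReal ∂(A.law P Mstar T) :=
      mul_nonneg (by positivity) (integral_nonneg fun _ => ENNReal.toReal_nonneg)
    linarith
  rw [EReal.coe_add]
  refine add_le_add le_rfl ?_
  -- With no rounds the product is zero even for an infinite coefficient.
  rcases Nat.eq_zero_or_pos T with rfl | hT
  · simp
  have hle : ∀ᵐ h ∂(A.law P Mstar T), ∀ t : Fin T,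
      (((A.mairAt P η (MAMS.past h t)).toReal : ℝ) : EReal) ≤ P.decKL η := by
    filter_upwards [h2] with h hh t
    have hf := MAMS.DecisionProblem.mair_finite_of_isSaddlePointOn hη (hh t)
    exact (EReal.coe_toReal hf.2 hf.1).trans_le (MAMS.BeliefAlgorithm.mairAt_le_decKL (hh t))
  generalize P.decKL η = d at hle
  induction d with
  | top =>
    rw [EReal.top_mul_of_pos (by exact_mod_cast hT)]
    exact le_top
  | bot =>
    -- Some history has a real MAIR value below the coefficient, which therefore is not `⊥`.
    obtain ⟨h, hh⟩ := hle.exists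
    exact absurd (hh ⟨0, hT⟩) (by simp)
  | coe d =>
    rw [← EReal.coe_natCast, ← EReal.coe_mul, EReal.coe_le_coe_iff]
    refine (integral_mono_ae h3 (integrable_const (d * T)) ?_).trans_eq (by simp)
    filter_upwards [hle] with h hh
    refine (Finset.sum_le_sum fun t _ => EReal.coe_le_coe_iff.1 (hh t)).trans_eq ?_
    simp [mul_comm]
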